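/- **Theorem.** For a field $k$ let $k((X^{-1}))$ be the field of formal power series in $X^{-1}$, with $|0|=0$ and $|F|=2^{m}$ if $F=\sum_{h\ge -m} f_hX^{-h}$ with $f_{-m}\neq 0$; let $\|F\|$ be the norm $|\cdot|$ of the fractional part $\sum_{h\ge 1} f_hX^{-h}$ of $F$. Call $\Theta$ badly approximable if $\inf_{q\in k[X]\setminus\{0\}}|q|\cdot\|q\Theta\|>0$. A pair $(\Theta,\Phi)$ satisfies the Littlewood conjecture if $$\inf_{q\in k[X]\setminus\{0\}}|q|\cdot\|q\Theta\|\cdot\|q\Phi\|=0,$$ and it does so non-trivially if, moreover, $\Theta$ and $\Phi$ are both badly approximable and $1,\Theta,\Phi$ are linearly independent over $k[X]$. Let $p\ge 7$ be a prime number. For $k\ge 0$ let $L_k(3)$ be the word $X/3,\,3X$ repeated $(p^k-1)/2$ times and $L_k(-1)$ the word $-X,\,-X$ repeated $(p^k-1)/2$ times (so $L_0(3)$ and $L_0(-1)$ are empty). Then there is exactly one power series $\Theta_p\in\mathbb F_p((X^{-1}))$ with the continued fraction expansion $$\Theta_p=[X,L_0(3),-X/3,L_0(-1),\,X,L_1(3),-X/3,L_1(-1),\,X,L_2(3),-X/3,L_2(-1),\ldots];$$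 it is a root of the polynomial of degree $p+1$ in $Z$ $$XZ^{p+1}-(X^2-3)Z^p+(Xf_{p-2}-3f_{p-1})Z-f_{p-2}(X^2-3)+3f_{p-1}X,\qquad f_k=\sum_{0\le 2j\le k}\binom{k-j}{j}X^{k-2j},$$ and the pair $(\Theta_p,\Theta_p^{-1})$ satisfies the Littlewood conjecture non-trivially. -/

import Mathlib

open Polynomial

noncomputable section

namespace PowerSeriesLittlewood

/-- The field `K((X⁻¹))` of formal power series `∑_{h ≥ -m} f_h X^{-h}`: Laurent series in the
variable `X⁻¹`, so that the coefficient of index `h` is the coefficient of `X^{-h}`. -/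
abbrev InvLaurent (K : Type*) [Field K] : Type _ := LaurentSeries K

variable {K : Type*} [Field K]

/-- The embedding of `K[X]` into `K((X⁻¹))`. It sends `X` to the series whose only non-zero
coefficient is a `1` at index `-1`, that is, at `X^{-(-1)}`. -/
def ofPoly (K : Type*) [Field K] : K[X] →+* InvLaurent K :=
  Polynomial.eval₂RingHom (HahnSeries.C : K →+* HahnSeries ℤ K) (HahnSeries.single (-1 : ℤ) (1 : K))

open Classical in
/-- `|0| = 0`, and `|F| = 2^m` if `F = ∑_{h ≥ -m} f_h X^{-h}` with `f_{-m} ≠ 0`. -/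
def absX (F : InvLaurent K) : ℝ := if F = 0 then 0 else (2 : ℝ) ^ (-F.order)

/-- The fractional part: the part of the series with the negative powers of `X` only. -/
def fracPart (F : InvLaurent K) : InvLaurent K :=
  HahnSeries.ofPowerSeries ℤ K
    (PowerSeries.mk fun n : ℕ => if n = 0 then 0 else F.coeff (n : ℤ))

/-- `‖F‖`, the norm of the fractional part of `F`. -/
def fracNorm (F : InvLaurent K) : ℝ := absX (fracPart F)

/-- The set of badly approximable power series. -/
def Bad (K : Type*) [Field K] : Set (InvLaurent K) :=
  {Θ | 0 < ⨅ q : {q : K[X] // q ≠ 0},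
    absX (ofPoly K (q : K[X])) * fracNorm (ofPoly K (q : K[X]) * Θ)}

/-- The pair `(Θ, Φ)` satisfies the Littlewood conjecture. -/
def SatisfiesLittlewood (Θ Φ : InvLaurent K) : Prop :=
  (⨅ q : {q : K[X] // q ≠ 0},
    absX (ofPoly K (q : K[X])) * fracNorm (ofPoly K (q : K[X]) * Θ)
      * fracNorm (ofPoly K (q : K[X]) * Φ)) = 0

/-- `1`, `Θ`, `Φ` are linearly independent over `K[X]`, for the embedding `ofPoly`. -/
def IndependentWithOne (Θ Φ : InvLaurent K) : Prop :=
  ∀ A B C : K[X], ofPoly K A + ofPoly K B * Θ + ofPoly K C * Φ = 0 → A = 0 ∧ B = 0 ∧ C = 0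

/-- The pair `(Θ, Φ)` satisfies the Littlewood conjecture non-trivially. -/
def SatisfiesLittlewoodNontrivially (Θ Φ : InvLaurent K) : Prop :=
  SatisfiesLittlewood Θ Φ ∧ Θ ∈ Bad K ∧ Φ ∈ Bad K ∧ IndependentWithOne Θ Φ

/-- The complete quotients of the continued fraction algorithm: `F_0 = F` and
`F_{n+1} = 1 / (F_n - a_n)`, where `a_n` is the polynomial part of `F_n`. -/
def completeQuotient (F : InvLaurent K) : ℕ → InvLaurent K
  | 0 => F
  | n + 1 => (fracPart (completeQuotient F n))⁻¹

/-- `F = [a_0, a_1, a_2, …]`: the continued fraction algorithm applied to `F` never stops, and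
the polynomial part of the `n`-th complete quotient is `a_n` for every `n`. -/
def HasContinuedFraction (F : InvLaurent K) (a : ℕ → K[X]) : Prop :=
  ∀ n, completeQuotient F n = ofPoly K (a n) + fracPart (completeQuotient F n) ∧
    fracPart (completeQuotient F n) ≠ 0

/-- `W^[l]`, the concatenation of `l` copies of the word `W`. -/
def wordPow {α : Type*} (W : List α) (l : ℕ) : List α := (List.replicate l W).flatten

/-- The word `X, L_k(3), -X/3, L_k(-1)` over `K[X]`, where
`L_k(3) = (X/3, 3X)^[(p^k-1)/2]` and `L_k(-1) = (-X, -X)^[(p^k-1)/2]`. -/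
def block (K : Type*) [Field K] (p k : ℕ) : List K[X] :=
  X :: (wordPow [C (3⁻¹ : K) * X, C (3 : K) * X] ((p ^ k - 1) / 2)
    ++ -(C (3⁻¹ : K) * X) :: wordPow [-X, -X] ((p ^ k - 1) / 2))

/-- The concatenation of the blocks of index `0, …, N-1`. -/
def blocks (K : Type*) [Field K] (p N : ℕ) : List K[X] :=
  (List.range N).flatMap (block K p)

/-- The `n`-th letter (counted from `0`) of the infinite word that is the concatenation of the
blocks of index `0, 1, 2, …`. The blocks have length at least `2`, so this letter belongs to the
concatenation of the first `n + 1` of them and the default value is never used. -/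
def millsRobbinsQuotient (p : ℕ) [Fact p.Prime] (n : ℕ) : (ZMod p)[X] :=
  (blocks (ZMod p) p (n + 1)).getD n 0

/-- `f_k = ∑_{0 ≤ 2j ≤ k} binom(k-j, j) X^{k-2j}`. -/
def fibPoly (K : Type*) [Field K] (k : ℕ) : K[X] :=
  ∑ j ∈ Finset.range (k / 2 + 1), C (((k - j).choose j : ℕ) : K) * X ^ (k - 2 * j)

/-- The polynomial (in the outer variable `Z`, with coefficients in `𝔽_p[X]`)
`X Z^{p+1} - (X² - 3) Z^p + (X f_{p-2} - 3 f_{p-1}) Z - f_{p-2} (X² - 3) + 3 f_{p-1} X`. -/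
def millsRobbinsPoly (p : ℕ) [Fact p.Prime] : (ZMod p)[X][X] :=
  C (X : (ZMod p)[X]) * X ^ (p + 1) - C (X ^ 2 - 3 : (ZMod p)[X]) * X ^ p
    + C (X * fibPoly (ZMod p) (p - 2) - 3 * fibPoly (ZMod p) (p - 1)) * X
    + C (-(fibPoly (ZMod p) (p - 2) * (X ^ 2 - 3)) + 3 * fibPoly (ZMod p) (p - 1) * X)

end PowerSeriesLittlewood

end

open PowerSeriesLittlewood

noncomputable section

namespace PowerSeriesLittlewood

variable {K : Type*} [Field K]

/-! All partial quotients are linear, so every complete quotient has absolute value 2 and the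
continued fraction map contracts. This gives existence and uniqueness of the series, and a descent
on $\deg q$ gives $|q|\cdot\|q\Theta\|\ge 1/2$, for $\Theta$ and for $\Theta^{-1}$
(`IsCompleteQuotients.half_le`, `IsCompleteQuotients.half_le_inv`).

The algebraic equation comes from a finite transducer. Frobenius sends $\lambda X+1/T$ to $\lambda
X^p+1/T^p$ when $\lambda\in\mathbb F_p$. After the Möbius map `raney p μ`, where the scalar $\mu$ is
the state, the result is again a continued fraction with linear partial quotients
(`transduces_letter`), thanks to $X^p=f_p+f_{p-2}$. In state $-1$ the block of index $k$ is
rewritten as the block of index $k+1$, back to state $-1$ (`transduces_block`). Hence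
$(\Theta^p+f_{p-2})/f_{p-1}$ is $\Theta$ with its block of index 0 removed, which is the equation of
degree $p+1$ (`raney_pow_eq`, `eval₂_millsRobbinsPoly`).

For the Littlewood conjecture, let $\Theta$ begin with $UV$, where $V$ is a palindrome. The matrix
of $UV\overline U$, with $\overline U$ the reversal of $U$, is symmetric, so its two columns
approximate $\Theta$ and $\Theta^{-1}$ with one denominator $q$, and the product is at most
$2^{2|U|+1-|V|}$ (`IsCompleteQuotients.exists_of_palindrome`). Take $V$ inside $L_k(3)$: $|V|$ is
about $p^k$ and $2|U|$ about $4p^k/(p-1)$, which is smaller because $p\ge 7$.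

Finally, a dependence between $1,\Theta,\Theta^{-1}$ would make $\Theta$ quadratic. Lagrange's
argument over a finite field would then make the expansion eventually periodic, which the
arbitrarily long words $L_k(3)$ followed by $-X/3$ forbid. -/

/-! ### The ultrametric absolute value -/

@[simp] lemma absX_zero : absX (0 : InvLaurent K) = 0 := by simp [absX]

lemma absX_of_ne {F : InvLaurent K} (h : F ≠ 0) : absX F = (2 : ℝ) ^ (-F.order) := by
  simp [absX, h]

lemma absX_pos {F : InvLaurent K} (h : F ≠ 0) : 0 < absX F := by
  rw [absX_of_ne h]; positivity

lemma absX_nonneg (F : InvLaurent K) : 0 ≤ absX F := by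
  by_cases h : F = 0
  · simp [h]
  · exact (absX_pos h).le

lemma ne_zero_of_absX_pos {F : InvLaurent K} (h : 0 < absX F) : F ≠ 0 := by
  rintro rfl; simp at h

@[simp] lemma absX_eq_zero {F : InvLaurent K} : absX F = 0 ↔ F = 0 :=
  ⟨fun h => by_contra fun h' => (absX_pos h').ne' h, fun h => by simp [h]⟩

/-- The bound `|F| ≤ 2^{-n}` read off the coefficients. -/
lemma absX_le_iff {F : InvLaurent K} {n : ℤ} :
    absX F ≤ (2 : ℝ) ^ (-n) ↔ ∀ j < n, F.coeff j = 0 := by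
  by_cases h : F = 0
  · simp [h]; positivity
  · rw [absX_of_ne h, zpow_le_zpow_iff_right₀ (by norm_num), neg_le_neg_iff]
    constructor
    · intro hn j hj
      exact HahnSeries.coeff_eq_zero_of_lt_order (lt_of_lt_of_le hj hn)
    · intro hn
      by_contra hlt
      push Not at hlt
      exact HahnSeries.coeff_order_eq_zero.not.mpr h (hn _ hlt)

lemma absX_mul (F G : InvLaurent K) : absX (F * G) = absX F * absX G := by
  by_cases hF : F = 0
  · simp [hF]
  by_cases hG : G = 0
  · simp [hG]
  rw [absX_of_ne hF, absX_of_ne hG, absX_of_ne (mul_ne_zero hF hG), HahnSeries.order_mul hF hG,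
    neg_add, zpow_add₀ (by norm_num)]

@[simp] lemma absX_one : absX (1 : InvLaurent K) = 1 := by
  rw [absX_of_ne one_ne_zero]; simp

@[simp] lemma absX_neg (F : InvLaurent K) : absX (-F) = absX F := by
  by_cases h : F = 0
  · simp [h]
  · rw [absX_of_ne h, absX_of_ne (neg_ne_zero.mpr h), HahnSeries.order_neg]

lemma absX_inv (F : InvLaurent K) : absX F⁻¹ = (absX F)⁻¹ := by
  by_cases hF : F = 0
  · simp [hF]
  · refine eq_inv_of_mul_eq_one_left ?_
    rw [← absX_mul, inv_mul_cancel₀ hF, absX_one]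

lemma absX_div (F G : InvLaurent K) : absX (F / G) = absX F / absX G := by
  rw [div_eq_mul_inv, absX_mul, absX_inv, div_eq_mul_inv]

lemma absX_pow (F : InvLaurent K) (n : ℕ) : absX (F ^ n) = absX F ^ n := by
  induction n with
  | zero => simp
  | succ n ih => rw [pow_succ, absX_mul, ih, pow_succ]

lemma absX_add_le {F G : InvLaurent K} {c : ℝ} (hF : absX F ≤ c) (hG : absX G ≤ c) :
    absX (F + G) ≤ c := by
  by_cases h1 : F = 0
  · simpa [h1]
  by_cases h2 : G = 0
  · simpa [h2]
  by_cases h3 : F + G = 0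
  · rw [h3, absX_zero]; exact (absX_nonneg F).trans hF
  have := HahnSeries.min_order_le_order_add h3
  rw [absX_of_ne h1] at hF
  rw [absX_of_ne h2] at hG
  rw [absX_of_ne h3]
  rcases min_le_iff.mp this with h | h
  · exact (zpow_le_zpow_right₀ (by norm_num) (neg_le_neg h)).trans hF
  · exact (zpow_le_zpow_right₀ (by norm_num) (neg_le_neg h)).trans hG

lemma absX_sub_le {F G : InvLaurent K} {c : ℝ} (hF : absX F ≤ c) (hG : absX G ≤ c) :
    absX (F - G) ≤ c := by
  rw [sub_eq_add_neg]; exact absX_add_le hF (by simpa using hG)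

lemma absX_sub_comm (F G : InvLaurent K) : absX (F - G) = absX (G - F) := by
  rw [← absX_neg, neg_sub]

lemma absX_add_eq_left {F G : InvLaurent K} (h : absX G < absX F) :
    absX (F + G) = absX F := by
  apply le_antisymm (absX_add_le le_rfl h.le)
  by_contra hlt
  push Not at hlt
  have := absX_sub_le (c := max (absX (F + G)) (absX G)) (le_max_left _ _) (le_max_right _ _)
  rw [add_sub_cancel_right] at this
  exact (max_lt hlt h).not_ge this

/-- In the ultrametric setting, an element at distance less than `|F|` from `F` has size `|F|`. -/
lemma absX_eq_of_sub_lt {F G : InvLaurent K} (h : absX (F - G) < absX F) : absX G = absX F := by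
  have := absX_add_eq_left (F := F) (G := G - F) (by rwa [absX_sub_comm])
  rwa [add_sub_cancel] at this

lemma eq_of_absX_sub_le {F G : InvLaurent K} {c : ℝ}
    (h : ∀ n : ℕ, absX (F - G) ≤ c * (1 / 2) ^ n) : F = G := by
  have : absX (F - G) ≤ 0 := by
    refine ge_of_tendsto' (x := Filter.atTop) (f := fun n : ℕ => c * (1 / 2 : ℝ) ^ n) ?_ h
    have := (tendsto_pow_atTop_nhds_zero_of_lt_one (r := (1 / 2 : ℝ)) (by norm_num)
      (by norm_num)).const_mul c
    simpa using this
  exact sub_eq_zero.mp (absX_eq_zero.mp (le_antisymm this (absX_nonneg _)))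

/-! ### Polynomials, fractional parts and completeness -/

lemma ofPoly_X : ofPoly K X = HahnSeries.single (-1 : ℤ) (1 : K) := by simp [ofPoly]

lemma ofPoly_C (c : K) : ofPoly K (C c) = HahnSeries.C c := by simp [ofPoly]

lemma ofPoly_monomial (n : ℕ) (c : K) :
    ofPoly K (monomial n c) = HahnSeries.single (-(n : ℤ)) c := by
  rw [← C_mul_X_pow_eq_monomial, map_mul, map_pow, ofPoly_X, ofPoly_C, HahnSeries.single_pow,
    HahnSeries.C_apply, HahnSeries.single_mul_single]
  simp

lemma ofPoly_coeff_neg (P : K[X]) (n : ℕ) : (ofPoly K P).coeff (-(n : ℤ)) = P.coeff n := by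
  induction P using Polynomial.induction_on' with
  | add p q hp hq => simp [hp, hq]
  | monomial m a =>
    rw [ofPoly_monomial, HahnSeries.coeff_single, coeff_monomial]
    simp [eq_comm]

lemma ofPoly_coeff_pos (P : K[X]) {n : ℤ} (hn : 0 < n) : (ofPoly K P).coeff n = 0 := by
  induction P using Polynomial.induction_on' with
  | add p q hp hq => simp [hp, hq]
  | monomial m a =>
    rw [ofPoly_monomial, HahnSeries.coeff_single_of_ne]
    omega

lemma ofPoly_injective : Function.Injective (ofPoly K) := by
  intro P Q h
  ext n
  rw [← ofPoly_coeff_neg, ← ofPoly_coeff_neg, h]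

lemma ofPoly_ne_zero {P : K[X]} (h : P ≠ 0) : ofPoly K P ≠ 0 :=
  (map_ne_zero_iff _ ofPoly_injective).mpr h

lemma absX_ofPoly_le {P : K[X]} {n : ℕ} :
    absX (ofPoly K P) ≤ 2 ^ n ↔ P.natDegree ≤ n := by
  have : ((2 : ℝ) ^ n) = 2 ^ (-(-(n : ℤ))) := by simp
  rw [this, absX_le_iff, natDegree_le_iff_coeff_eq_zero]
  constructor
  · intro h N hN
    rw [← ofPoly_coeff_neg]; exact h _ (by omega)
  · intro h j hj
    obtain ⟨m, rfl⟩ : ∃ m : ℕ, j = -(m : ℤ) := ⟨j.natAbs, by omega⟩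
    rw [ofPoly_coeff_neg]; exact h _ (by omega)

lemma absX_ofPoly {P : K[X]} (h : P ≠ 0) : absX (ofPoly K P) = 2 ^ P.natDegree := by
  apply le_antisymm (absX_ofPoly_le.mpr le_rfl)
  rw [absX_of_ne (ofPoly_ne_zero h), ← zpow_natCast,
    zpow_le_zpow_iff_right₀ (by norm_num), le_neg]
  refine HahnSeries.order_le_of_coeff_ne_zero ?_
  rw [ofPoly_coeff_neg]
  simpa using h

lemma one_le_absX_ofPoly {P : K[X]} (h : P ≠ 0) : 1 ≤ absX (ofPoly K P) := by
  rw [absX_ofPoly h]; exact one_le_pow₀ (by norm_num)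

lemma fracPart_coeff (F : InvLaurent K) (n : ℤ) :
    (fracPart F).coeff n = if 0 < n then F.coeff n else 0 := by
  rcases lt_or_ge n 0 with h | h
  · rw [if_neg (by omega), fracPart, HahnSeries.ofPowerSeries_apply]
    apply HahnSeries.embDomain_of_notMem_range
    simp; omega
  · obtain ⟨m, rfl⟩ := Int.eq_ofNat_of_zero_le h
    rw [fracPart, HahnSeries.ofPowerSeries_apply_coeff, PowerSeries.coeff_mk]
    rcases Nat.eq_zero_or_pos m with rfl | hm
    · simp
    · rw [if_neg hm.ne', if_pos (by omega)]

lemma absX_fracPart_le (F : InvLaurent K) : absX (fracPart F) ≤ absX F := by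
  by_cases h : F = 0
  · have : fracPart F = 0 := by ext n; simp [fracPart_coeff, h]
    rw [this, h]
  · rw [absX_of_ne h, absX_le_iff]
    intro j hj
    rw [fracPart_coeff, HahnSeries.coeff_eq_zero_of_lt_order hj, ite_self]

lemma absX_lt_one_iff {F : InvLaurent K} : absX F < 1 ↔ ∀ j ≤ 0, F.coeff j = 0 := by
  have : absX F < 1 ↔ absX F ≤ 2 ^ (-(1 : ℤ)) := by
    by_cases h : F = 0
    · simp [h]
    · rw [absX_of_ne h, zpow_le_zpow_iff_right₀ (by norm_num),
        ← zpow_zero (2 : ℝ), zpow_lt_zpow_iff_right₀ (by norm_num)]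
      omega
  rw [this, absX_le_iff]
  exact ⟨fun h j hj => h j (by omega), fun h j hj => h j (by omega)⟩

lemma absX_fracPart_lt_one (F : InvLaurent K) : absX (fracPart F) < 1 := by
  rw [absX_lt_one_iff]
  intro j hj
  rw [fracPart_coeff, if_neg (by omega)]

lemma fracPart_ofPoly_add (P : K[X]) (F : InvLaurent K) :
    fracPart (ofPoly K P + F) = fracPart F := by
  ext n
  rw [fracPart_coeff, fracPart_coeff]
  split_ifs with h
  · simp [ofPoly_coeff_pos P h]
  · rfl

lemma fracPart_of_lt_one {F : InvLaurent K} (h : absX F < 1) : fracPart F = F := by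
  ext n
  rw [fracPart_coeff]
  split_ifs with hn
  · rfl
  · rw [absX_lt_one_iff.mp h _ (by omega)]

lemma exists_ofPoly_add_fracPart (F : InvLaurent K) :
    ∃ P : K[X], F = ofPoly K P + fracPart F := by
  refine ⟨∑ i ∈ Finset.range ((-F.order).toNat + 1), monomial i (F.coeff (-(i : ℤ))), ?_⟩
  ext n
  rw [HahnSeries.coeff_add, fracPart_coeff]
  split_ifs with h
  · rw [ofPoly_coeff_pos _ h, zero_add]
  · obtain ⟨m, rfl⟩ : ∃ m : ℕ, n = -(m : ℤ) := ⟨n.natAbs, by omega⟩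
    rw [ofPoly_coeff_neg, add_zero, finsetSum_coeff]
    simp only [coeff_monomial, Finset.sum_ite_eq', Finset.mem_range]
    split_ifs with hm
    · rfl
    · exact HahnSeries.coeff_eq_zero_of_lt_order (by omega)

lemma fracNorm_le (F : InvLaurent K) (P : K[X]) : fracNorm F ≤ absX (F - ofPoly K P) := by
  have h := fracPart_ofPoly_add P (F - ofPoly K P)
  rw [add_sub_cancel] at h
  rw [fracNorm, h]
  exact absX_fracPart_le _

lemma exists_fracNorm_eq (F : InvLaurent K) : ∃ P : K[X], fracNorm F = absX (F - ofPoly K P) := by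
  obtain ⟨P, hP⟩ := exists_ofPoly_add_fracPart F
  exact ⟨P, by rw [fracNorm]; congr 1; exact eq_sub_of_add_eq' hP.symm⟩

lemma fracNorm_nonneg (F : InvLaurent K) : 0 ≤ fracNorm F := absX_nonneg _

/-- A sequence with `|c_{n+1} - c_n| ≤ 2^{-n}` converges in `K((X⁻¹))`. -/
lemma exists_limit (c : ℕ → InvLaurent K)
    (hc : ∀ n : ℕ, absX (c (n + 1) - c n) ≤ 2 ^ (-(n : ℤ))) :
    ∃ F : InvLaurent K, ∀ n : ℕ, absX (F - c n) ≤ 2 ^ (-(n : ℤ)) := by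
  have hstep : ∀ (n : ℕ) (j : ℤ), j < n → (c (n + 1)).coeff j = (c n).coeff j := by
    intro n j hj
    have := absX_le_iff.mp (hc n) j hj
    rwa [HahnSeries.coeff_sub, sub_eq_zero] at this
  have hstab : ∀ (m n : ℕ) (j : ℤ), j < n → (c (n + m)).coeff j = (c n).coeff j := by
    intro m n j hj
    induction m with
    | zero => rfl
    | succ m ih => rw [← ih, ← add_assoc, hstep _ _ (by push_cast; omega)]
  let f : ℤ → K := fun j => (c (j.toNat + 1)).coeff j
  have hf : ∀ (n : ℕ) (j : ℤ), j < n → f j = (c n).coeff j := by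
    intro n j hj
    rcases le_total n (j.toNat + 1) with h | h
    · obtain ⟨m, hm⟩ := Nat.exists_eq_add_of_le h
      simp only [f]
      rw [hm, hstab m n j hj]
    · obtain ⟨m, hm⟩ := Nat.exists_eq_add_of_le h
      simp only [f]
      rw [hm, hstab m _ j (by push_cast; omega)]
  have hbdd : BddBelow (Function.support f) := by
    -- At negative indices the limit already agrees with `c 0`.
    refine ⟨min 0 (c 0).order, fun j hj => ?_⟩
    by_contra hlt
    push Not at hlt
    refine hj ?_
    rw [hf 0 j (by simpa using hlt.trans_le (min_le_left _ _))]
    exact HahnSeries.coeff_eq_zero_of_lt_order (hlt.trans_le (min_le_right _ _))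
  refine ⟨⟨f, hbdd.isWF.isPWO⟩, fun n => absX_le_iff.mpr fun j hj => ?_⟩
  rw [HahnSeries.coeff_sub, sub_eq_zero]
  exact hf n j hj

/-! ### Continued fractions with linear partial quotients -/

lemma absX_ofPoly_of_natDegree_eq_one {a : K[X]} (h : a.natDegree = 1) :
    absX (ofPoly K a) = 2 := by
  rw [absX_ofPoly (by rintro rfl; simp at h), h, pow_one]

lemma absX_inv_sub_inv {F G : InvLaurent K} (hF : absX F = 2) (hG : absX G = 2) :
    absX (F⁻¹ - G⁻¹) = absX (F - G) / 4 := by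
  have h1 : F ≠ 0 := ne_zero_of_absX_pos (by rw [hF]; norm_num)
  have h2 : G ≠ 0 := ne_zero_of_absX_pos (by rw [hG]; norm_num)
  have : F⁻¹ - G⁻¹ = (G - F) / (F * G) := by field_simp
  rw [this, absX_div, absX_mul, hF, hG, absX_sub_comm]
  norm_num

lemma absX_ofPoly_add_inv {a : K[X]} {F : InvLaurent K} (ha : a.natDegree = 1)
    (hF : absX F = 2) : absX (ofPoly K a + F⁻¹) = 2 := by
  have h := absX_ofPoly_of_natDegree_eq_one ha
  rw [absX_add_eq_left, h]
  rw [h, absX_inv, hF]; norm_num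

/-- `T` is the sequence of complete quotients of the continued fraction with linear partial
quotients `a`. -/
structure IsCompleteQuotients (T : ℕ → InvLaurent K) (a : ℕ → K[X]) : Prop where
  eq : ∀ n, T n = ofPoly K (a n) + (T (n + 1))⁻¹
  absX_eq : ∀ n, absX (T n) = 2

lemma IsCompleteQuotients.ne_zero {T : ℕ → InvLaurent K} {a : ℕ → K[X]}
    (h : IsCompleteQuotients T a) (n : ℕ) : T n ≠ 0 :=
  ne_zero_of_absX_pos (by rw [h.absX_eq]; norm_num)

/-- The value of the finite continued fraction `[w_0, …, w_{n-1}, T]`. -/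
def evalCF (w : List K[X]) (T : InvLaurent K) : InvLaurent K :=
  w.foldr (fun a F => ofPoly K a + F⁻¹) T

@[simp] lemma evalCF_nil (T : InvLaurent K) : evalCF [] T = T := rfl

@[simp] lemma evalCF_cons (a : K[X]) (w : List K[X]) (T : InvLaurent K) :
    evalCF (a :: w) T = ofPoly K a + (evalCF w T)⁻¹ := rfl

lemma evalCF_append (u w : List K[X]) (T : InvLaurent K) :
    evalCF (u ++ w) T = evalCF u (evalCF w T) := by
  simp [evalCF, List.foldr_append]

lemma absX_evalCF {w : List K[X]} (hw : ∀ a ∈ w, a.natDegree = 1) {T : InvLaurent K}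
    (hT : absX T = 2) : absX (evalCF w T) = 2 := by
  induction w with
  | nil => simpa
  | cons a w ih =>
    rw [evalCF_cons]
    exact absX_ofPoly_add_inv (hw a (by simp)) (ih fun b hb => hw b (by simp [hb]))

/-- Each inversion divides distances by 4; the bound kept here gains only a factor 2 per letter,
which suffices. -/
lemma absX_evalCF_sub {w : List K[X]} (hw : ∀ a ∈ w, a.natDegree = 1) {T U : InvLaurent K}
    (hT : absX T = 2) (hU : absX U = 2) :
    absX (evalCF w T - evalCF w U) ≤ 2 * (1 / 2) ^ w.length := by
  induction w with
  | nil => simpa using absX_sub_le hT.le hU.le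
  | cons a w ih =>
    have hw' : ∀ b ∈ w, b.natDegree = 1 := fun b hb => hw b (by simp [hb])
    rw [evalCF_cons, evalCF_cons, add_sub_add_left_eq_sub,
      absX_inv_sub_inv (absX_evalCF hw' hT) (absX_evalCF hw' hU), List.length_cons, pow_succ]
    have := ih hw'
    have h0 := absX_nonneg (evalCF w T - evalCF w U)
    linarith

/-- The word `w` occurs in the sequence `a` at position `i`. -/
def OccursAt (a : ℕ → K[X]) (i : ℕ) (w : List K[X]) : Prop :=
  ∀ j (h : j < w.length), a (i + j) = w[j]

lemma OccursAt.tail {a : ℕ → K[X]} {i : ℕ} {b : K[X]} {w : List K[X]}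
    (h : OccursAt a i (b :: w)) : OccursAt a (i + 1) w := by
  intro j hj
  have := h (j + 1) (by simpa using hj)
  rw [List.getElem_cons_succ] at this
  rw [← this]; congr 1; omega

lemma OccursAt.natDegree_eq {a : ℕ → K[X]} (ha : ∀ n, (a n).natDegree = 1) {i : ℕ}
    {w : List K[X]} (h : OccursAt a i w) : ∀ b ∈ w, b.natDegree = 1 := by
  intro b hb
  obtain ⟨j, hj, rfl⟩ := List.getElem_of_mem hb
  rw [← h j hj, ha]

lemma IsCompleteQuotients.eq_evalCF {T : ℕ → InvLaurent K} {a : ℕ → K[X]}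
    (h : IsCompleteQuotients T a) {i : ℕ} {w : List K[X]} (hw : OccursAt a i w) :
    T i = evalCF w (T (i + w.length)) := by
  induction w generalizing i with
  | nil => simp
  | cons b w ih =>
    have h0 := hw 0 (by simp)
    simp only [add_zero, List.getElem_cons_zero] at h0
    rw [evalCF_cons, h.eq i, h0, ih hw.tail, List.length_cons]
    congr 4
    omega

lemma IsCompleteQuotients.unique {T U : ℕ → InvLaurent K} {a : ℕ → K[X]}
    (ha : ∀ n, (a n).natDegree = 1)
    (hT : IsCompleteQuotients T a) (hU : IsCompleteQuotients U a) : T 0 = U 0 := by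
  refine eq_of_absX_sub_le (c := 2) fun n => ?_
  have hw : OccursAt a 0 (List.ofFn fun i : Fin n => a i) := by
    intro j hj; simp
  rw [hT.eq_evalCF hw, hU.eq_evalCF hw]
  have := absX_evalCF_sub (hw.natDegree_eq ha) (hT.absX_eq (0 + (List.ofFn fun i : Fin n => a i).length))
    (hU.absX_eq (0 + (List.ofFn fun i : Fin n => a i).length))
  simpa using this

/-- The continued fraction `[a_k, …, a_{k+n}]`. -/
def convergent (a : ℕ → K[X]) : ℕ → ℕ → InvLaurent K
  | k, 0 => ofPoly K (a k)
  | k, n + 1 => ofPoly K (a k) + (convergent a (k + 1) n)⁻¹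

lemma convergent_succ (a : ℕ → K[X]) (k n : ℕ) :
    convergent a k (n + 1) = ofPoly K (a k) + (convergent a (k + 1) n)⁻¹ := rfl

lemma absX_convergent {a : ℕ → K[X]} (ha : ∀ n, (a n).natDegree = 1) (k n : ℕ) :
    absX (convergent a k n) = 2 := by
  induction n generalizing k with
  | zero => exact absX_ofPoly_of_natDegree_eq_one (ha k)
  | succ n ih => exact absX_ofPoly_add_inv (ha k) (ih _)

lemma absX_convergent_succ_sub {a : ℕ → K[X]} (ha : ∀ n, (a n).natDegree = 1) (k n : ℕ) :
    absX (convergent a k (n + 1) - convergent a k n) ≤ 2 ^ (-(n : ℤ)) := by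
  induction n generalizing k with
  | zero =>
    simp only [convergent, add_sub_cancel_left, absX_inv,
      absX_ofPoly_of_natDegree_eq_one (ha _)]
    norm_num
  | succ n ih =>
    rw [convergent_succ a k (n + 1), convergent_succ a k n, add_sub_add_left_eq_sub,
      absX_inv_sub_inv (absX_convergent ha _ _) (absX_convergent ha _ _)]
    have h1 := ih (k + 1)
    have h2 : (2 : ℝ) ^ (-((n + 1 : ℕ) : ℤ)) = 2 ^ (-(n : ℤ)) / 2 := by
      push_cast
      rw [neg_add, zpow_add₀ (by norm_num)]
      norm_num; ring
    have h3 : (0 : ℝ) < 2 ^ (-(n : ℤ)) := by positivity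
    rw [h2]
    linarith

/-- Every sequence of linear polynomials is the sequence of partial quotients of a power
series. -/
lemma exists_isCompleteQuotients {a : ℕ → K[X]} (ha : ∀ n, (a n).natDegree = 1) :
    ∃ T, IsCompleteQuotients T a := by
  choose T hT using fun k => exists_limit (convergent a k) (absX_convergent_succ_sub ha k)
  have habs : ∀ k, absX (T k) = 2 := by
    intro k
    have h1 := hT k 0
    have h2 := absX_convergent ha k 0
    rw [absX_sub_comm] at h1
    rw [absX_eq_of_sub_lt (F := convergent a k 0) (G := T k), h2]
    rw [h2]
    norm_num at h1
    linarith
  refine ⟨T, fun k => ?_, habs⟩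
  refine eq_of_absX_sub_le (c := 1) fun n => ?_
  have h1 := hT k (n + 1)
  have h2 := hT (k + 1) n
  have h3 : (2 : ℝ) ^ (-((n : ℕ) : ℤ)) = 1 * (1 / 2) ^ n := by simp
  have h4 : (2 : ℝ) ^ (-((n + 1 : ℕ) : ℤ)) = 1 * (1 / 2) ^ n / 2 := by
    rw [zpow_neg, zpow_natCast, pow_succ]; simp; ring
  have h5 : (0 : ℝ) < (1 / 2) ^ n := by positivity
  have : T k - (ofPoly K (a k) + (T (k + 1))⁻¹) =
      (T k - convergent a k (n + 1)) - ((T (k + 1))⁻¹ - (convergent a (k + 1) n)⁻¹) := by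
    rw [convergent]; ring
  rw [this]
  refine absX_sub_le ?_ ?_
  · rw [h4] at h1
    linarith
  · rw [absX_inv_sub_inv (habs _) (absX_convergent ha _ _)]
    rw [h3] at h2
    linarith

lemma IsCompleteQuotients.shift {T : ℕ → InvLaurent K} {a : ℕ → K[X]}
    (h : IsCompleteQuotients T a) (i : ℕ) :
    IsCompleteQuotients (fun n => T (i + n)) fun n => a (i + n) :=
  ⟨fun n => h.eq (i + n), fun _ => h.absX_eq _⟩

lemma IsCompleteQuotients.fracPart_eq {T : ℕ → InvLaurent K} {a : ℕ → K[X]}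
    (h : IsCompleteQuotients T a) (n : ℕ) : fracPart (T n) = (T (n + 1))⁻¹ := by
  rw [h.eq n, fracPart_ofPoly_add, fracPart_of_lt_one]
  rw [absX_inv, h.absX_eq]; norm_num

lemma IsCompleteQuotients.partialQuotient_eq {T U : ℕ → InvLaurent K} {a b : ℕ → K[X]}
    (hT : IsCompleteQuotients T a) (hU : IsCompleteQuotients U b) (h : T 0 = U 0) (n : ℕ) :
    a n = b n := by
  have hn : T n = U n := by
    induction n with
    | zero => exact h
    | succ n ih =>
      have h1 := hT.fracPart_eq n
      rw [ih, hU.fracPart_eq n] at h1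
      exact (inv_injective h1).symm
  have hn' : T (n + 1) = U (n + 1) := by
    have h1 := hT.fracPart_eq n
    rw [hn, hU.fracPart_eq n] at h1
    exact (inv_injective h1).symm
  have h2 := hT.eq n
  rw [hn, hn', hU.eq n] at h2
  exact (ofPoly_injective (add_right_cancel h2)).symm

lemma hasContinuedFraction_iff {T : ℕ → InvLaurent K} {a : ℕ → K[X]}
    (ha : ∀ n, (a n).natDegree = 1) (hT : IsCompleteQuotients T a) (F : InvLaurent K) :
    HasContinuedFraction F a ↔ F = T 0 := by
  constructor
  · intro hF
    have hU : IsCompleteQuotients (completeQuotient F) a := by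
      constructor
      · intro n
        rw [completeQuotient, inv_inv]
        exact (hF n).1
      · intro n
        rw [(hF n).1, absX_add_eq_left, absX_ofPoly_of_natDegree_eq_one (ha n)]
        rw [absX_ofPoly_of_natDegree_eq_one (ha n)]
        linarith [absX_fracPart_lt_one (completeQuotient F n)]
    exact hU.unique ha hT
  · rintro rfl
    have hq : ∀ n, completeQuotient (T 0) n = T n := by
      intro n
      induction n with
      | zero => rfl
      | succ n ih => rw [completeQuotient, ih, hT.fracPart_eq, inv_inv]
    intro n
    rw [hq, hT.fracPart_eq]
    exact ⟨hT.eq n, inv_ne_zero (hT.ne_zero _)⟩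

/-! ### Matrices of words -/

/-- The matrix `∏ [a, 1; 1, 0]` of a word. -/
def wordMatrix (w : List K[X]) : Matrix (Fin 2) (Fin 2) K[X] :=
  (w.map fun a => !![a, 1; 1, 0]).prod

@[simp] lemma wordMatrix_nil : wordMatrix ([] : List K[X]) = 1 := rfl

lemma wordMatrix_cons (a : K[X]) (w : List K[X]) :
    wordMatrix (a :: w) = !![a, 1; 1, 0] * wordMatrix w := by simp [wordMatrix]

lemma wordMatrix_append (u w : List K[X]) :
    wordMatrix (u ++ w) = wordMatrix u * wordMatrix w := by simp [wordMatrix]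

/-- The denominator of the Möbius transformation attached to `w`, evaluated at `T`. -/
def cfDenom (w : List K[X]) (T : InvLaurent K) : InvLaurent K :=
  ofPoly K (wordMatrix w 1 0) * T + ofPoly K (wordMatrix w 1 1)

/-- Prepending a letter multiplies the denominator by the complete quotient `evalCF w T`, so the
denominator is a product of `w.length` factors of absolute value 2. -/
lemma evalCF_mul_cfDenom {w : List K[X]} (hw : ∀ a ∈ w, a.natDegree = 1) {T : InvLaurent K}
    (hT : absX T = 2) :
    absX (cfDenom w T) = 2 ^ w.length ∧ evalCF w T * cfDenom w T =
      ofPoly K (wordMatrix w 0 0) * T + ofPoly K (wordMatrix w 0 1) := by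
  induction w with
  | nil => simp [cfDenom]
  | cons a w ih =>
    have hw' : ∀ b ∈ w, b.natDegree = 1 := fun b hb => hw b (by simp [hb])
    obtain ⟨h1, h2⟩ := ih hw'
    have h3 := absX_evalCF hw' hT
    have h4 : evalCF w T ≠ 0 := ne_zero_of_absX_pos (by rw [h3]; norm_num)
    have h5 : cfDenom (a :: w) T = evalCF w T * cfDenom w T := by
      rw [h2, cfDenom, wordMatrix_cons]
      simp [Matrix.mul_apply, Fin.sum_univ_two]
    refine ⟨?_, ?_⟩
    · rw [h5, absX_mul, h3, h1, List.length_cons, pow_succ, mul_comm]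
    · rw [h5, evalCF_cons, add_mul, ← mul_assoc (evalCF w T)⁻¹, inv_mul_cancel₀ h4, h2,
        wordMatrix_cons, cfDenom]
      simp [Matrix.mul_apply, Fin.sum_univ_two]
      ring

/-! ### Bad approximability -/

/-- Descent step. If $|qG^{-1}-s|<1$ then $|s|=|q|/2$, and $qG^{-1}-s=-(sG-q)G^{-1}$ shows that the
product for $(q,G^{-1})$ equals the product for $(s,G)$. The other cases are trivial since nonzero
polynomials have absolute value at least 1. -/
lemma half_le_of_inv {G : InvLaurent K} (hG : absX G = 2) {q : K[X]} (hq : q ≠ 0)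
    (h : ∀ s : K[X], s ≠ 0 → 2 * absX (ofPoly K s) = absX (ofPoly K q) →
      1 / 2 ≤ absX (ofPoly K s) * absX (ofPoly K s * G - ofPoly K q)) (s : K[X]) :
    1 / 2 ≤ absX (ofPoly K q) * absX (ofPoly K q * G⁻¹ - ofPoly K s) := by
  have hG0 : G ≠ 0 := ne_zero_of_absX_pos (by rw [hG]; norm_num)
  have hq1 := one_le_absX_ofPoly hq
  rcases eq_or_ne s 0 with rfl | hs
  · rw [map_zero, sub_zero, absX_mul, absX_inv, hG]
    nlinarith
  rcases le_or_gt 1 (absX (ofPoly K q * G⁻¹ - ofPoly K s)) with h1 | h1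
  · nlinarith
  have hs1 := one_le_absX_ofPoly hs
  have h2 : absX (ofPoly K q * G⁻¹) = absX (ofPoly K s) := by
    apply absX_eq_of_sub_lt
    rw [absX_sub_comm]
    linarith
  rw [absX_mul, absX_inv, hG] at h2
  have h3 := h s hs (by rw [← h2]; ring)
  have h4 : ofPoly K q * G⁻¹ - ofPoly K s = -((ofPoly K s * G - ofPoly K q) * G⁻¹) := by
    field_simp
    ring
  rw [h4, absX_neg, absX_mul _ G⁻¹, absX_inv, hG]
  have h5 : absX (ofPoly K q) = 2 * absX (ofPoly K s) := by rw [← h2]; ring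
  rw [h5]
  linarith

/-- A continued fraction with linear partial quotients is badly approximable. -/
lemma IsCompleteQuotients.half_le {T : ℕ → InvLaurent K} {a : ℕ → K[X]}
    (hT : IsCompleteQuotients T a) {q : K[X]} (hq : q ≠ 0) (k : ℕ) (r : K[X]) :
    1 / 2 ≤ absX (ofPoly K q) * absX (ofPoly K q * T k - ofPoly K r) := by
  induction hn : q.natDegree using Nat.strong_induction_on generalizing q r k with
  | _ n ih =>
    have h1 : ofPoly K q * T k - ofPoly K r =
        ofPoly K q * (T (k + 1))⁻¹ - ofPoly K (r - q * a k) := by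
      rw [hT.eq k, map_sub, map_mul]; ring
    rw [h1]
    refine half_le_of_inv (hT.absX_eq _) hq (fun s hs hsq => ?_) _
    refine ih s.natDegree ?_ hs _ _ rfl
    rw [absX_ofPoly hs, absX_ofPoly hq, ← pow_succ'] at hsq
    have := Nat.pow_right_injective le_rfl (by exact_mod_cast hsq : 2 ^ (s.natDegree + 1) = 2 ^ q.natDegree)
    omega

lemma IsCompleteQuotients.half_le_inv {T : ℕ → InvLaurent K} {a : ℕ → K[X]}
    (hT : IsCompleteQuotients T a) {q : K[X]} (hq : q ≠ 0) (k : ℕ) (r : K[X]) :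
    1 / 2 ≤ absX (ofPoly K q) * absX (ofPoly K q * (T k)⁻¹ - ofPoly K r) :=
  half_le_of_inv (hT.absX_eq _) hq (fun _ hs _ => hT.half_le hs _ _) _

lemma mem_Bad_of_le {Θ : InvLaurent K} {c : ℝ} (hc : 0 < c)
    (h : ∀ q r : K[X], q ≠ 0 → c ≤ absX (ofPoly K q) * absX (ofPoly K q * Θ - ofPoly K r)) :
    Θ ∈ Bad K := by
  have : Nonempty {q : K[X] // q ≠ 0} := ⟨⟨1, one_ne_zero⟩⟩
  refine hc.trans_le (le_ciInf fun q => ?_)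
  obtain ⟨r, hr⟩ := exists_fracNorm_eq (ofPoly K (q : K[X]) * Θ)
  rw [hr]
  exact h q r q.2

/-! ### Quadratic series have periodic expansions -/

/-- Lagrange's argument without loss of height. The equation itself bounds $B$ by $A$ and $C$.
Passing to the next complete quotient $G$, with $F=a+G^{-1}$, the old $A$ becomes the constant term,
and the new leading coefficient is $-G^{-1}(A(2F-G^{-1})+B)$, whose size is at most $2^D$ again. -/
lemma IsCompleteQuotients.exists_quadratic {T : ℕ → InvLaurent K} {a : ℕ → K[X]}
    (hT : IsCompleteQuotients T a) {A B C : K[X]} {D : ℕ} (h0 : ¬(A = 0 ∧ B = 0 ∧ C = 0))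
    (h : ofPoly K A * T 0 ^ 2 + ofPoly K B * T 0 + ofPoly K C = 0)
    (hA : absX (ofPoly K A) ≤ 2 ^ D) (hC : absX (ofPoly K C) ≤ 2 ^ D) (n : ℕ) :
    ∃ A B C : K[X], ¬(A = 0 ∧ B = 0 ∧ C = 0) ∧
      ofPoly K A * T n ^ 2 + ofPoly K B * T n + ofPoly K C = 0 ∧
      absX (ofPoly K A) ≤ 2 ^ D ∧ absX (ofPoly K B) ≤ 2 ^ (D + 1) ∧
      absX (ofPoly K C) ≤ 2 ^ D := by
  have hB : ∀ (n : ℕ) (A B C : K[X]),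
      ofPoly K A * T n ^ 2 + ofPoly K B * T n + ofPoly K C = 0 →
      absX (ofPoly K A) ≤ 2 ^ D → absX (ofPoly K C) ≤ 2 ^ D →
      absX (ofPoly K B) ≤ 2 ^ (D + 1) := by
    intro n A B C h hA hC
    have h1 : ofPoly K B * T n = -(ofPoly K A * T n ^ 2 + ofPoly K C) := by
      linear_combination h
    have h2 : absX (ofPoly K B * T n) ≤ 4 * 2 ^ D := by
      rw [h1, absX_neg]
      refine absX_add_le ?_ ?_
      · rw [absX_mul, absX_pow, hT.absX_eq]; linarith
      · linarith [show (0 : ℝ) < 2 ^ D by positivity]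
    rw [absX_mul, hT.absX_eq] at h2
    rw [pow_succ]; linarith
  induction n with
  | zero => exact ⟨A, B, C, h0, h, hA, hB 0 A B C h hA hC, hC⟩
  | succ n ih =>
    obtain ⟨A, B, C, h0, h, hA, hB', hC⟩ := ih
    have hG0 := hT.ne_zero (n + 1)
    have hF := hT.eq n
    have hFa := hT.absX_eq n
    have hGa := hT.absX_eq (n + 1)
    set G := T (n + 1)
    set F := T n
    have h' : ofPoly K (A * a n ^ 2 + B * a n + C) * G ^ 2 + ofPoly K (2 * A * a n + B) * G
        + ofPoly K A = 0 := by
      have : (ofPoly K A * F ^ 2 + ofPoly K B * F + ofPoly K C) * G ^ 2 = 0 := by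
        rw [h, zero_mul]
      rw [hF] at this
      simp only [map_add, map_mul, map_pow, map_ofNat]
      rw [← this]
      field_simp
      ring
    have hA' : absX (ofPoly K (A * a n ^ 2 + B * a n + C)) ≤ 2 ^ D := by
      have h1 : ofPoly K (A * a n ^ 2 + B * a n + C) =
          -(G⁻¹ * (ofPoly K A * (F - G⁻¹ + F) + ofPoly K B)) := by
        simp only [map_add, map_mul, map_pow]
        rw [eq_sub_of_add_eq hF.symm]
        linear_combination h
      rw [h1, absX_neg, absX_mul, absX_inv, hGa]
      have h2 : absX (F - G⁻¹ + F) ≤ 2 :=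
        absX_add_le (absX_sub_le hFa.le (by rw [absX_inv, hGa]; norm_num)) hFa.le
      have h3 : absX (ofPoly K A * (F - G⁻¹ + F) + ofPoly K B) ≤ 2 ^ (D + 1) := by
        refine absX_add_le ?_ hB'
        rw [absX_mul, pow_succ]
        exact mul_le_mul hA h2 (absX_nonneg _) (by positivity)
      rw [pow_succ] at h3
      linarith
    refine ⟨_, _, _, ?_, h', hA', hB _ _ _ _ h' hA' hA, hA⟩
    rintro ⟨h1, h2, h3⟩
    subst h3
    have hB0 : B = 0 := by simpa using h2
    subst hB0
    exact h0 ⟨rfl, rfl, by simpa using h1⟩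

/-- Over a finite field, the complete quotients of a quadratic continued fraction take some value
twice. -/
lemma IsCompleteQuotients.exists_eq_of_quadratic [Finite K] {T : ℕ → InvLaurent K}
    {a : ℕ → K[X]} (hT : IsCompleteQuotients T a) {A B C : K[X]} (h0 : ¬(A = 0 ∧ B = 0 ∧ C = 0))
    (h : ofPoly K A * T 0 ^ 2 + ofPoly K B * T 0 + ofPoly K C = 0) :
    ∃ i j, i < j ∧ T i = T j := by
  set D := max A.natDegree C.natDegree
  choose A' B' C' hne hroot hA' hB' hC' using hT.exists_quadratic (D := D) h0 h
    (absX_ofPoly_le.mpr (le_max_left _ _)) (absX_ofPoly_le.mpr (le_max_right _ _))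
  have hmem : ∀ P : K[X], absX (ofPoly K P) ≤ 2 ^ (D + 1) → P ∈ degreeLT K (D + 2) := by
    intro P hP
    rw [absX_ofPoly_le] at hP
    rw [mem_degreeLT]
    exact (degree_le_of_natDegree_le hP).trans_lt (by exact_mod_cast Nat.lt_succ_self _)
  have hle : (2 : ℝ) ^ D ≤ 2 ^ (D + 1) := pow_le_pow_right₀ (by norm_num) (Nat.le_succ _)
  have : Finite (degreeLT K (D + 2)) := Finite.of_equiv _ (degreeLTEquiv K (D + 2)).symm.toEquiv
  let f : ℕ → degreeLT K (D + 2) × degreeLT K (D + 2) × degreeLT K (D + 2) := fun n =>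
    (⟨A' n, hmem _ ((hA' n).trans hle)⟩, ⟨B' n, hmem _ (hB' n)⟩, ⟨C' n, hmem _ ((hC' n).trans hle)⟩)
  obtain ⟨y, hy⟩ := Finite.exists_infinite_fiber f
  have hinf : (f ⁻¹' {y}).Infinite := Set.infinite_coe_iff.mp hy
  obtain ⟨i, hi, -⟩ := hinf.exists_gt 0
  obtain ⟨j, hj, hij⟩ := hinf.exists_gt i
  obtain ⟨k, hk, hjk⟩ := hinf.exists_gt j
  have hroots : ∀ n, f n = y → ofPoly K (y.1 : K[X]) * T n ^ 2 + ofPoly K (y.2.1 : K[X]) * T n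
      + ofPoly K (y.2.2 : K[X]) = 0 := by
    rintro n rfl
    exact hroot n
  have hy0 : ¬((y.1 : K[X]) = 0 ∧ (y.2.1 : K[X]) = 0 ∧ (y.2.2 : K[X]) = 0) := by
    rw [← (show f i = y from hi)]
    exact hne i
  -- Three indices share one nonzero quadratic equation; three distinct roots would force all its
  -- coefficients to vanish.
  by_contra hcon
  push Not at hcon
  have hij' := sub_ne_zero.mpr (hcon i j hij)
  have hjk' := sub_ne_zero.mpr (hcon j k hjk)
  have hik' := sub_ne_zero.mpr (hcon i k (hij.trans hjk))
  have ri := hroots i hi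
  have rj := hroots j hj
  have rk := hroots k hk
  have e1 : ofPoly K (y.1 : K[X]) * (T i + T j) + ofPoly K (y.2.1 : K[X]) = 0 :=
    mul_left_cancel₀ hij' (by linear_combination ri - rj)
  have e2 : ofPoly K (y.1 : K[X]) * (T i + T k) + ofPoly K (y.2.1 : K[X]) = 0 :=
    mul_left_cancel₀ hik' (by linear_combination ri - rk)
  have z1 : ofPoly K (y.1 : K[X]) = 0 := mul_left_cancel₀ hjk' (by linear_combination e1 - e2)
  have z2 : ofPoly K (y.2.1 : K[X]) = 0 := by simpa [z1] using e1
  have z3 : ofPoly K (y.2.2 : K[X]) = 0 := by simpa [z1, z2] using ri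
  rw [map_eq_zero_iff _ ofPoly_injective] at z1 z2 z3
  exact hy0 ⟨z1, z2, z3⟩

lemma IsCompleteQuotients.exists_periodic_of_not_independent [Finite K] {T : ℕ → InvLaurent K}
    {a : ℕ → K[X]} (hT : IsCompleteQuotients T a)
    (h : ¬ IndependentWithOne (T 0) (T 0)⁻¹) :
    ∃ i d, 0 < d ∧ ∀ n, i ≤ n → a (n + d) = a n := by
  simp only [IndependentWithOne, not_forall] at h
  obtain ⟨A, B, C, h, h0⟩ := h
  have hT0 := hT.ne_zero 0
  obtain ⟨i, j, hij, he⟩ := hT.exists_eq_of_quadratic (A := B) (B := A) (C := C)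
    (fun h' => h0 ⟨h'.2.1, h'.1, h'.2.2⟩) (by
      have : (ofPoly K A + ofPoly K B * T 0 + ofPoly K C * (T 0)⁻¹) * T 0 = 0 := by
        rw [h, zero_mul]
      rw [← this]
      field_simp
      ring)
  refine ⟨i, j - i, by omega, fun n hn => ?_⟩
  have := (hT.shift i).partialQuotient_eq (hT.shift j) he (n - i)
  rw [show i + (n - i) = n by omega, show j + (n - i) = n + (j - i) by omega] at this
  exact this.symm

/-! ### The polynomials $f_k$ -/

lemma fibPoly_zero : fibPoly K 0 = 1 := by simp [fibPoly]

lemma fibPoly_one : fibPoly K 1 = X := by simp [fibPoly]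

lemma fibPoly_eq_sum_antidiagonal (k : ℕ) : fibPoly K k =
    ∑ x ∈ Finset.HasAntidiagonal.antidiagonal k, C ((x.1.choose x.2 : ℕ) : K) * X ^ (x.1 - x.2) := by
  rw [← Finset.Nat.sum_antidiagonal_swap, Finset.Nat.sum_antidiagonal_eq_sum_range_succ_mk, fibPoly]
  refine Finset.sum_subset_zero_on_sdiff ?_ ?_ ?_
  · intro j hj
    simp only [Finset.mem_range] at hj ⊢
    omega
  · intro j hj
    simp only [Finset.mem_sdiff, Finset.mem_range] at hj
    simp only [Prod.swap_prod_mk]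
    rw [Nat.choose_eq_zero_of_lt (by omega)]
    simp
  · intro j hj
    simp only [Prod.swap_prod_mk]
    congr 2
    omega

lemma fibPoly_add_two (k : ℕ) : fibPoly K (k + 2) = X * fibPoly K (k + 1) + fibPoly K k := by
  simp only [fibPoly_eq_sum_antidiagonal]
  rw [Finset.Nat.sum_antidiagonal_succ', Finset.Nat.sum_antidiagonal_succ,
    Finset.Nat.sum_antidiagonal_succ' (n := k), mul_add, Finset.mul_sum]
  have : ∀ x ∈ Finset.HasAntidiagonal.antidiagonal k,
      C (((x.1 + 1).choose (x.2 + 1) : ℕ) : K) * X ^ (x.1 + 1 - (x.2 + 1)) =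
      X * (C ((x.1.choose (x.2 + 1) : ℕ) : K) * X ^ (x.1 - (x.2 + 1))) +
        C ((x.1.choose x.2 : ℕ) : K) * X ^ (x.1 - x.2) := by
    intro x _
    rw [Nat.choose_succ_succ, Nat.add_sub_add_right]
    rcases lt_or_ge x.1 (x.2 + 1) with h | h
    · rw [Nat.choose_eq_zero_of_lt h]; simp
    · obtain ⟨m, hm⟩ := Nat.exists_eq_add_of_le h
      rw [show x.1 - x.2 = m + 1 by omega, show x.1 - (x.2 + 1) = m by omega]
      push_cast [map_add]
      ring
  rw [Finset.sum_congr rfl this, Finset.sum_add_distrib]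
  simp
  ring

lemma absX_fibPoly (k : ℕ) : absX (ofPoly K (fibPoly K k)) = 2 ^ k := by
  have hX : absX (ofPoly K (X : K[X])) = 2 := absX_ofPoly_of_natDegree_eq_one natDegree_X
  induction k using Nat.twoStepInduction with
  | zero => simp [fibPoly_zero]
  | one => simp [fibPoly_one, hX]
  | more k h1 h2 =>
    have h3 : absX (ofPoly K X * ofPoly K (fibPoly K (k + 1))) = 2 ^ (k + 2) := by
      rw [absX_mul, hX, h2, ← pow_succ']
    rw [fibPoly_add_two, map_add, map_mul, absX_add_eq_left, h3]
    rw [h1, h3]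
    exact pow_lt_pow_right₀ (by norm_num) (by omega)

lemma fibPoly_mul_sub_sq (n : ℕ) :
    fibPoly K (n + 2) * fibPoly K n - fibPoly K (n + 1) ^ 2 = (-1) ^ n := by
  induction n with
  | zero => simp [fibPoly_add_two, fibPoly_zero, fibPoly_one]; ring
  | succ n ih =>
    rw [pow_succ (-1 : K[X]), ← ih, fibPoly_add_two (n + 1), fibPoly_add_two n]
    ring

lemma matrix_pow_fibPoly (n : ℕ) : (!![X, 1; 1, 0] : Matrix (Fin 2) (Fin 2) K[X]) ^ (n + 2) =
    !![fibPoly K (n + 2), fibPoly K (n + 1); fibPoly K (n + 1), fibPoly K n] := by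
  induction n with
  | zero =>
    ext i j : 1
    fin_cases i <;> fin_cases j <;>
      simp [pow_succ, Matrix.mul_apply, Fin.sum_univ_two, fibPoly_add_two, fibPoly_zero,
        fibPoly_one]
  | succ n ih =>
    rw [pow_succ', ih]
    ext i j : 1
    fin_cases i <;> fin_cases j <;>
      simp [Matrix.mul_apply, Fin.sum_univ_two, fibPoly_add_two]

/-- In characteristic `p`, the Lucas polynomial of index `p` is `X ^ p`. -/
lemma X_pow_char_eq_fibPoly (p n : ℕ) [Fact p.Prime] [CharP K p] (hn : p = n + 2) :
    (X : K[X]) ^ p = fibPoly K p + fibPoly K n := by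
  -- $M$ commutes with its adjugate and their sum is the scalar $\operatorname{tr}M=X$. In
  -- characteristic $p$ the $p$-th power is additive on commuting elements, so
  -- $X^p=\operatorname{tr}M^p$.
  set M : Matrix (Fin 2) (Fin 2) K[X] := !![X, 1; 1, 0] with hM
  have h1 : M + M.adjugate = Matrix.scalar (Fin 2) X := by
    ext i j : 1
    fin_cases i <;> fin_cases j <;> simp [hM, Matrix.adjugate_fin_two]
  have h2 : Commute M M.adjugate := by
    rw [Commute, SemiconjBy, Matrix.mul_adjugate, Matrix.adjugate_mul]
  have h3 : M ^ p = !![fibPoly K p, fibPoly K (n + 1); fibPoly K (n + 1), fibPoly K n] := by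
    subst hn
    exact matrix_pow_fibPoly n
  have h4 := add_pow_char_of_commute p h2
  rw [h1, ← Matrix.adjugate_pow, h3, ← map_pow] at h4
  have h5 := congrFun (congrFun h4 0) 0
  simpa [Matrix.adjugate_fin_two] using h5

/-! ### Periodic words and their matrices -/

@[simp] lemma wordPow_zero {α : Type*} (W : List α) : wordPow W 0 = [] := by simp [wordPow]

lemma wordPow_succ {α : Type*} (W : List α) (l : ℕ) :
    wordPow W (l + 1) = W ++ wordPow W l := by
  simp [wordPow, List.replicate_succ]

lemma wordPow_add {α : Type*} (W : List α) (k l : ℕ) :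
    wordPow W (k + l) = wordPow W k ++ wordPow W l := by
  rw [wordPow, List.replicate_add, List.flatten_append]; rfl

lemma length_wordPow {α : Type*} (W : List α) (l : ℕ) :
    (wordPow W l).length = l * W.length := by
  simp [wordPow]

lemma mem_of_mem_wordPow {α : Type*} {W : List α} {l : ℕ} {a : α} (h : a ∈ wordPow W l) :
    a ∈ W := by
  simp only [wordPow, List.mem_flatten, List.mem_replicate] at h
  obtain ⟨_, ⟨-, rfl⟩, h⟩ := h
  exact h

lemma cons_wordPow_swap {α : Type*} (a b : α) (l : ℕ) :
    a :: (wordPow [b, a] l ++ [b]) = wordPow [a, b] (l + 1) := by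
  induction l with
  | zero => simp [wordPow_succ]
  | succ l ih => rw [wordPow_succ _ (l + 1), ← ih, wordPow_succ]; simp

/-- With $M$ the matrix of the letter $X$, the matrix of the pair $cX,c^{-1}X$ is the conjugate of
$M^2$ by $\operatorname{diag}(c,1)$. The entries are thus those of $M^{2r+2}$, up to $c$ and
$c^{-1}$ off the diagonal. -/
lemma wordMatrix_wordPow {c : K} (hc : c ≠ 0) (r : ℕ) :
    wordMatrix (wordPow [C c * X, C c⁻¹ * X] (r + 1)) =
      !![fibPoly K (2 * r + 2), C c * fibPoly K (2 * r + 1);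
        C c⁻¹ * fibPoly K (2 * r + 1), fibPoly K (2 * r)] := by
  have hcc : (C c * C c⁻¹ : K[X]) = 1 := by rw [← C_mul, mul_inv_cancel₀ hc, C_1]
  induction r with
  | zero =>
    rw [wordPow_succ, wordPow_zero, List.append_nil, wordMatrix_cons, wordMatrix_cons,
      wordMatrix_nil, mul_one]
    ext i j : 1
    fin_cases i <;> fin_cases j <;>
      simp [Matrix.mul_apply, Fin.sum_univ_two, fibPoly_add_two, fibPoly_zero, fibPoly_one]
    linear_combination X ^ 2 * hcc
  | succ r ih =>
    rw [wordPow_succ, wordMatrix_append, ih, wordMatrix_cons, wordMatrix_cons,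
      wordMatrix_nil, mul_one, show 2 * (r + 1) = 2 * r + 2 by ring,
      fibPoly_add_two (2 * r + 2), show 2 * r + 2 + 1 = 2 * r + 1 + 2 by ring,
      fibPoly_add_two (2 * r + 1), show 2 * r + 1 + 1 = 2 * r + 2 by ring]
    have hrec := fibPoly_add_two (K := K) (2 * r)
    ext i j : 1
    fin_cases i <;> fin_cases j <;>
      simp [Matrix.mul_apply, Fin.sum_univ_two]
    · linear_combination (X ^ 2 * fibPoly K (2 * r + 2) + X * fibPoly K (2 * r + 1)) * hcc
    · linear_combination (X ^ 2 * C c * fibPoly K (2 * r + 1)) * hcc - C c * X * hrec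
    · ring
    · linear_combination (X * fibPoly K (2 * r + 1)) * hcc - hrec

/-! ### The Frobenius transducer -/

section Transducer
variable (p : ℕ) [Fact p.Prime]

/-- The map `Y ↦ (Y - μ f_{p-2}) / f_{p-1}`. -/
def raney (μ : ZMod p) (Y : InvLaurent (ZMod p)) : InvLaurent (ZMod p) :=
  (Y - ofPoly _ (C μ * fibPoly _ (p - 2))) / ofPoly _ (fibPoly _ (p - 1))

lemma absX_raney (hp : 2 ≤ p) (μ : ZMod p) {Y : InvLaurent (ZMod p)} (hY : absX Y = 2 ^ p) :
    absX (raney p μ Y) = 2 := by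
  have h1 : absX (-ofPoly _ (C μ * fibPoly (ZMod p) (p - 2))) ≤ 2 ^ (p - 2) := by
    rw [absX_neg, absX_ofPoly_le]
    exact (natDegree_C_mul_le _ _).trans (absX_ofPoly_le.mp (absX_fibPoly _).le)
  have h2 : (2 : ℝ) ^ (p - 2) < 2 ^ p := pow_lt_pow_right₀ (by norm_num) (by omega)
  rw [raney, absX_div, sub_eq_add_neg, absX_add_eq_left (by rw [hY]; linarith), hY, absX_fibPoly]
  obtain ⟨n, rfl⟩ : ∃ n, p = n + 1 := ⟨p - 1, by omega⟩
  rw [pow_succ]; simp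

/-- The map `Y ↦ Y ^ p`, followed by `raney p μ`, turns continued fractions beginning with `u`
into continued fractions beginning with `w`; the state `μ` becomes `ν`. -/
structure Transduces (μ ν : ZMod p) (u w : List (ZMod p)[X]) : Prop where
  natDegree_eq : ∀ a ∈ u, a.natDegree = 1
  natDegree_eq' : ∀ a ∈ w, a.natDegree = 1
  eq : ∀ T : InvLaurent (ZMod p), absX T = 2 →
    raney p μ (evalCF u T ^ p) = evalCF w (raney p ν (T ^ p))

variable {p}

lemma Transduces.nil (μ : ZMod p) : Transduces p μ μ [] [] :=
  ⟨by simp, by simp, fun _ _ => rfl⟩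

lemma Transduces.append {μ ν ρ : ZMod p} {u u' w w' : List (ZMod p)[X]}
    (h : Transduces p μ ν u w) (h' : Transduces p ν ρ u' w') :
    Transduces p μ ρ (u ++ u') (w ++ w') := by
  refine ⟨fun a ha => ?_, fun a ha => ?_, fun T hT => ?_⟩
  · exact (List.mem_append.mp ha).elim (h.natDegree_eq a) (h'.natDegree_eq a)
  · exact (List.mem_append.mp ha).elim (h.natDegree_eq' a) (h'.natDegree_eq' a)
  · rw [evalCF_append, evalCF_append, h.eq _ (absX_evalCF h'.natDegree_eq hT), h'.eq T hT]

/-- The four hypotheses on the matrix $W$ of `w` say exactly that $W\begin{pmatrix}1&-\nu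
f_{p-2}\\0&f_{p-1}\end{pmatrix}=\begin{pmatrix}1&-\mu
f_{p-2}\\0&f_{p-1}\end{pmatrix}\begin{pmatrix}\lambda X^p&1\\1&0\end{pmatrix}$, an equality of
Möbius maps applied to $Y=T^p$. -/
lemma transduces_letter {lam μ ν : ZMod p} (hl : lam ≠ 0) {w : List (ZMod p)[X]}
    (hw : ∀ a ∈ w, a.natDegree = 1)
    (h00 : wordMatrix w 0 0 = C lam * X ^ p - C μ * fibPoly _ (p - 2))
    (h01 : fibPoly _ (p - 1) * wordMatrix w 0 1 =
      (C lam * X ^ p - C μ * fibPoly _ (p - 2)) * (C ν * fibPoly _ (p - 2)) + 1)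
    (h10 : wordMatrix w 1 0 = fibPoly _ (p - 1))
    (h11 : wordMatrix w 1 1 = C ν * fibPoly _ (p - 2)) :
    Transduces p μ ν [C lam * X] w := by
  refine ⟨?_, hw, fun T hT => ?_⟩
  · intro a ha
    rw [List.mem_singleton.mp ha]
    exact natDegree_C_mul_X _ hl
  have hY : absX (T ^ p) = 2 ^ p := by rw [absX_pow, hT]
  have hU := absX_raney p (Fact.out : p.Prime).two_le ν hY
  obtain ⟨-, h2⟩ := evalCF_mul_cfDenom hw hU
  have hY0 : T ^ p ≠ 0 := ne_zero_of_absX_pos (by rw [hY]; positivity)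
  have hg0 : ofPoly (ZMod p) (fibPoly _ (p - 1)) ≠ 0 :=
    ne_zero_of_absX_pos (by rw [absX_fibPoly]; positivity)
  have hgU : ofPoly (ZMod p) (fibPoly _ (p - 1)) * raney p ν (T ^ p) =
      T ^ p - ofPoly _ (C ν * fibPoly _ (p - 2)) := by
    rw [raney, mul_div_cancel₀ _ hg0]
  have hden : cfDenom w (raney p ν (T ^ p)) = T ^ p := by
    rw [cfDenom, h10, h11, hgU]; ring
  rw [hden] at h2
  have hB := congrArg (ofPoly (ZMod p)) h01
  rw [h00] at h2
  simp only [map_mul, map_add, map_sub, map_one, map_pow] at h2 hB hgU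
  apply mul_right_cancel₀ hY0
  rw [h2]
  have hfrob : (evalCF [C lam * X] T) ^ p =
      ofPoly _ (C lam) * ofPoly _ X ^ p + (T ^ p)⁻¹ := by
    have : CharP (InvLaurent (ZMod p)) p :=
      charP_of_injective_ringHom (f := (ofPoly (ZMod p)).comp C)
        (ofPoly_injective.comp C_injective) p
    rw [evalCF_cons, evalCF_nil, add_pow_char, map_mul, mul_pow, ← map_pow, ← C_pow,
      ZMod.pow_card, inv_pow]
  rw [hfrob, raney]
  apply mul_left_cancel₀ hg0
  rw [← mul_assoc, mul_div_cancel₀ _ hg0, mul_add, hB]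
  simp only [map_mul]
  have hinv : (T ^ p)⁻¹ * T ^ p = 1 := inv_mul_cancel₀ hY0
  linear_combination hinv - (ofPoly _ (C lam) * ofPoly _ X ^ p
    - ofPoly _ (C μ) * ofPoly _ (fibPoly _ (p - 2))) * hgU

lemma natDegree_wordPow {c : ZMod p} (hc : c ≠ 0) {r : ℕ} :
    ∀ a ∈ wordPow [C c * X, C c⁻¹ * X] r, a.natDegree = 1 := by
  intro a ha
  have := mem_of_mem_wordPow ha
  simp only [List.mem_cons, List.not_mem_nil, or_false] at this
  rcases this with rfl | rfl
  · exact natDegree_C_mul_X _ hc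
  · exact natDegree_C_mul_X _ (inv_ne_zero hc)

lemma fibPoly_relations {r : ℕ} (hr : p = 2 * r + 3) :
    fibPoly (ZMod p) (p - 1) = X * fibPoly _ (p - 2) + fibPoly _ (2 * r) ∧
    (X : (ZMod p)[X]) ^ p = X * fibPoly _ (p - 1) + 2 * fibPoly _ (p - 2) ∧
    fibPoly (ZMod p) (p - 1) * fibPoly _ (2 * r) = fibPoly _ (p - 2) ^ 2 + 1 := by
  have e1 : p - 1 = 2 * r + 2 := by omega
  have e2 : p - 2 = 2 * r + 1 := by omega
  have h1 := fibPoly_add_two (K := ZMod p) (2 * r)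
  have h2 := fibPoly_add_two (K := ZMod p) (2 * r + 1)
  have h3 := X_pow_char_eq_fibPoly (K := ZMod p) p (2 * r + 1) (by omega)
  have h4 := fibPoly_mul_sub_sq (K := ZMod p) (2 * r)
  rw [(even_two_mul r).neg_one_pow] at h4
  have h5 : fibPoly (ZMod p) p = fibPoly (ZMod p) (2 * r + 1 + 2) := congrArg _ hr
  rw [e1, e2]
  refine ⟨h1, ?_, by linear_combination h4⟩
  rw [h3, h5, h2]; ring

lemma wordMatrix_wordPow_prime {r : ℕ} (hr : p = 2 * r + 3) {c : ZMod p} (hc : c ≠ 0) :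
    wordMatrix (wordPow [C c * X, C c⁻¹ * X] (r + 1)) =
      !![fibPoly _ (p - 1), C c * fibPoly _ (p - 2);
        C c⁻¹ * fibPoly _ (p - 2), fibPoly _ (2 * r)] := by
  rw [wordMatrix_wordPow hc, show p - 1 = 2 * r + 2 by omega, show p - 2 = 2 * r + 1 by omega]

/-- Since $X^p=Xf_{p-1}+2f_{p-2}$, reading $\lambda X$ in state $\mu$ gives the entry $\lambda
Xf_{p-1}+(2\lambda-\mu)f_{p-2}$, so the new state is $(2\lambda-\mu)^{-1}$. For $\lambda=\mu=c$ this
is $c^{-1}$, and two letters $cX,c^{-1}X$ restore the state. -/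
lemma transduces_linear {r : ℕ} (hr : p = 2 * r + 3) {c : ZMod p} (hc : c ≠ 0) :
    Transduces p c c⁻¹ [C c * X] (wordPow [C c * X, C c⁻¹ * X] (r + 1) ++ [C c * X]) := by
  obtain ⟨h1, h2, h3⟩ := fibPoly_relations hr
  have hcc : (C c * C c⁻¹ : (ZMod p)[X]) = 1 := by rw [← C_mul, mul_inv_cancel₀ hc, C_1]
  have hM : wordMatrix (wordPow [C c * X, C c⁻¹ * X] (r + 1) ++ [C c * X]) =
      !![fibPoly _ (p - 1) * (C c * X) + C c * fibPoly _ (p - 2), fibPoly _ (p - 1);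
        C c⁻¹ * fibPoly _ (p - 2) * (C c * X) + fibPoly _ (2 * r), C c⁻¹ * fibPoly _ (p - 2)] := by
    rw [wordMatrix_append, wordMatrix_wordPow_prime hr hc, wordMatrix_cons, wordMatrix_nil, mul_one]
    simp
  refine transduces_letter hc ?_ ?_ ?_ ?_ ?_
  · intro a ha
    rcases List.mem_append.mp ha with h | h
    · exact natDegree_wordPow hc a h
    · rw [List.mem_singleton.mp h]; exact natDegree_C_mul_X _ hc
  all_goals rw [hM]; simp only [Matrix.of_apply, Matrix.cons_val', Matrix.cons_val_zero,
    Matrix.cons_val_one, Matrix.cons_val_fin_one]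
  · linear_combination -(C c) * h2
  · rw [h2]
    linear_combination fibPoly (ZMod p) (p - 1) * h1 + h3
      - (X * fibPoly _ (p - 1) * fibPoly _ (p - 2) + fibPoly _ (p - 2) ^ 2) * hcc
  · linear_combination X * fibPoly (ZMod p) (p - 2) * hcc - h1

lemma transduces_pair {r : ℕ} (hr : p = 2 * r + 3) {c : ZMod p} (hc : c ≠ 0) :
    Transduces p c c [C c * X, C c⁻¹ * X] (wordPow [C c * X, C c⁻¹ * X] p) := by
  have h := (transduces_linear hr hc).append (transduces_linear hr (inv_ne_zero hc))
  rw [inv_inv] at h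
  have hw : wordPow [C c * X, C c⁻¹ * X] p = (wordPow [C c * X, C c⁻¹ * X] (r + 1) ++ [C c * X]) ++
      (wordPow [C c⁻¹ * X, C c * X] (r + 1) ++ [C c⁻¹ * X]) := by
    rw [List.append_assoc, List.singleton_append, cons_wordPow_swap, ← wordPow_add]
    congr 1; omega
  rw [hw]
  exact h

lemma transduces_wordPow {r : ℕ} (hr : p = 2 * r + 3) {c : ZMod p} (hc : c ≠ 0) (l : ℕ) :
    Transduces p c c (wordPow [C c * X, C c⁻¹ * X] l) (wordPow [C c * X, C c⁻¹ * X] (p * l)) := by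
  induction l with
  | zero => simpa using Transduces.nil c
  | succ l ih =>
    rw [wordPow_succ, mul_add, mul_one, add_comm, wordPow_add]
    exact (transduces_pair hr hc).append ih

/-- The number 3 enters here: with $\lambda=1$ and $\mu=-1$, $2\lambda-\mu=3$. -/
lemma transduces_X {r : ℕ} (hr : p = 2 * r + 3) (h3 : (3 : ZMod p) ≠ 0) :
    Transduces p (-1) 3⁻¹ (X :: []) (X :: wordPow [C 3⁻¹ * X, C 3 * X] (r + 1)) := by
  obtain ⟨e1, e2, e3⟩ := fibPoly_relations hr
  have h3' : (3⁻¹ : ZMod p) ≠ 0 := inv_ne_zero h3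
  have hcc : (3 * C (3⁻¹ : ZMod p) : (ZMod p)[X]) = 1 := by
    rw [← C_ofNat, ← C_mul, mul_inv_cancel₀ h3, C_1]
  have hM := wordMatrix_wordPow_prime hr h3'
  rw [inv_inv] at hM
  have hdeg := natDegree_wordPow h3' (r := r + 1)
  rw [inv_inv] at hdeg
  have hM' : wordMatrix (X :: wordPow [C (3⁻¹ : ZMod p) * X, C 3 * X] (r + 1)) =
      !![X * fibPoly _ (p - 1) + 3 * fibPoly _ (p - 2),
        X * (C 3⁻¹ * fibPoly _ (p - 2)) + fibPoly _ (2 * r);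
        fibPoly _ (p - 1), C 3⁻¹ * fibPoly _ (p - 2)] := by
    rw [wordMatrix_cons, hM, C_ofNat]
    simp
  have := transduces_letter (p := p) (lam := 1) (μ := -1) (ν := 3⁻¹) one_ne_zero
    (w := X :: wordPow [C (3⁻¹ : ZMod p) * X, C 3 * X] (r + 1)) ?_ ?_ ?_ ?_ ?_
  · simpa using this
  · intro a ha
    rcases List.mem_cons.mp ha with rfl | h
    · exact natDegree_X
    · exact hdeg a h
  all_goals rw [hM']; simp only [Matrix.of_apply, Matrix.cons_val', Matrix.cons_val_zero,
    Matrix.cons_val_one, Matrix.cons_val_fin_one, C_neg, C_1]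
  · linear_combination -e2
  · rw [e2]
    linear_combination e3 - fibPoly (ZMod p) (p - 2) ^ 2 * hcc

/-- The state returns to $-1$ because $2\cdot(-1/3)-1/3=-1$; this is what singles out the letter
$-X/3$. -/
lemma transduces_neg {r : ℕ} (hr : p = 2 * r + 3) (h3 : (3 : ZMod p) ≠ 0) :
    Transduces p 3⁻¹ (-1) [-(C 3⁻¹ * X)] (-(C 3⁻¹ * X) :: wordPow [-X, -X] (r + 1)) := by
  obtain ⟨e1, e2, e3⟩ := fibPoly_relations hr
  have h3' : (3⁻¹ : ZMod p) ≠ 0 := inv_ne_zero h3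
  have hcc : (3 * C (3⁻¹ : ZMod p) : (ZMod p)[X]) = 1 := by
    rw [← C_ofNat, ← C_mul, mul_inv_cancel₀ h3, C_1]
  have h1 : (-1 : ZMod p) ≠ 0 := neg_ne_zero.mpr one_ne_zero
  have hM := wordMatrix_wordPow_prime hr h1
  have hdeg := natDegree_wordPow h1 (r := r + 1)
  have hneg : [C (-1 : ZMod p) * X, C (-1)⁻¹ * X] = [-X, -X] := by simp
  rw [hneg] at hM hdeg
  have hM' : wordMatrix (-(C (3⁻¹ : ZMod p) * X) :: wordPow [-X, -X] (r + 1)) =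
      !![-(C 3⁻¹ * X) * fibPoly _ (p - 1) - fibPoly _ (p - 2),
        C 3⁻¹ * X * fibPoly _ (p - 2) + fibPoly _ (2 * r);
        fibPoly _ (p - 1), -fibPoly _ (p - 2)] := by
    rw [wordMatrix_cons, hM]
    simp [sub_eq_add_neg]
  have := transduces_letter (p := p) (lam := -3⁻¹) (μ := 3⁻¹) (ν := -1) (neg_ne_zero.mpr h3')
    (w := -(C (3⁻¹ : ZMod p) * X) :: wordPow [-X, -X] (r + 1)) ?_ ?_ ?_ ?_ ?_
  · simpa using this
  · intro a ha
    rcases List.mem_cons.mp ha with rfl | h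
    · rw [natDegree_neg]; exact natDegree_C_mul_X _ h3'
    · exact hdeg a h
  all_goals rw [hM']; simp only [Matrix.of_apply, Matrix.cons_val', Matrix.cons_val_zero,
    Matrix.cons_val_one, Matrix.cons_val_fin_one, C_neg, C_1]
  · rw [e2]
    linear_combination fibPoly (ZMod p) (p - 2) * hcc
  · rw [e2]
    linear_combination e3 - fibPoly (ZMod p) (p - 2) ^ 2 * hcc
  · ring

/-- Each of the letters $X$ and $-X/3$ emits itself and $(p-1)/2$ pairs, and each pair read emits
$p$ pairs; the counts match as $(p^{k+1}-1)/2=(p-1)/2+p\,(p^k-1)/2$. -/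
lemma transduces_block {r : ℕ} (hr : p = 2 * r + 3) (h3 : (3 : ZMod p) ≠ 0) (k : ℕ) :
    Transduces p (-1) (-1) (block (ZMod p) p k) (block (ZMod p) p (k + 1)) := by
  have h3' : (3⁻¹ : ZMod p) ≠ 0 := inv_ne_zero h3
  have h1 : (-1 : ZMod p) ≠ 0 := neg_ne_zero.mpr one_ne_zero
  have hneg : [C (-1 : ZMod p) * X, C (-1)⁻¹ * X] = [-X, -X] := by simp
  have t1 := transduces_wordPow hr h3' ((p ^ k - 1) / 2)
  have t2 := transduces_wordPow hr h1 ((p ^ k - 1) / 2)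
  rw [inv_inv] at t1
  rw [hneg] at t2
  have hlen : (p ^ (k + 1) - 1) / 2 = (r + 1) + p * ((p ^ k - 1) / 2) := by
    have hodd : Odd (p ^ k) := Odd.pow ⟨r + 1, by omega⟩
    obtain ⟨m, hm⟩ := hodd
    rw [pow_succ, hm, show (2 * m + 1 - 1) / 2 = m by omega,
      show (2 * m + 1) * p = 2 * (p * m) + p by ring]
    omega
  have h := (transduces_X hr h3).append (t1.append ((transduces_neg hr h3).append t2))
  rw [block, block, hlen, wordPow_add _ (r + 1), wordPow_add _ (r + 1)]
  simpa using h

end Transducer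

/-! ### Palindromes and simultaneous approximation -/

lemma det_wordMatrix (w : List K[X]) : (wordMatrix w).det = (-1) ^ w.length := by
  induction w with
  | nil => simp
  | cons a w ih => rw [wordMatrix_cons, Matrix.det_mul, ih, List.length_cons, pow_succ']; simp

lemma absX_det_wordMatrix (w : List K[X]) : absX (ofPoly K (wordMatrix w).det) = 1 := by
  rw [det_wordMatrix, map_pow, absX_pow]; simp

lemma transpose_wordMatrix (w : List K[X]) : (wordMatrix w).transpose = wordMatrix w.reverse := by
  induction w with
  | nil => simp
  | cons a w ih =>
    rw [wordMatrix_cons, Matrix.transpose_mul, ih, List.reverse_cons, wordMatrix_append]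
    congr 1
    rw [wordMatrix_cons, wordMatrix_nil, mul_one]
    ext i j : 1
    fin_cases i <;> fin_cases j <;> rfl

lemma absX_wordMatrix_le {w : List K[X]} (hw : ∀ a ∈ w, a.natDegree = 1) (i j : Fin 2) :
    absX (ofPoly K (wordMatrix w i j)) ≤ 2 ^ w.length := by
  induction w generalizing i with
  | nil => fin_cases i <;> fin_cases j <;> simp
  | cons a w ih =>
    have hw' : ∀ b ∈ w, b.natDegree = 1 := fun b hb => hw b (by simp [hb])
    have ha := absX_ofPoly_of_natDegree_eq_one (hw a (by simp))
    have h0 := ih hw' 0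
    have h1 := ih hw' 1
    have hpos : (0 : ℝ) < 2 ^ w.length := by positivity
    rw [wordMatrix_cons, List.length_cons, pow_succ]
    fin_cases i
    · simp only [Fin.zero_eta, Matrix.mul_apply, Fin.sum_univ_two, Matrix.of_apply,
        Matrix.cons_val', Matrix.cons_val_zero, Matrix.cons_val_one, Matrix.cons_val_fin_one,
        one_mul, map_add, map_mul]
      refine absX_add_le ?_ ?_
      · rw [absX_mul, ha]; linarith
      · linarith
    · simp only [Fin.mk_one, Matrix.mul_apply, Fin.sum_univ_two, Matrix.of_apply,
        Matrix.cons_val', Matrix.cons_val_zero, Matrix.cons_val_one, Matrix.cons_val_fin_one,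
        one_mul, zero_mul, add_zero]
      linarith

/-- The columns of a product `M_w S` give good rational approximations to every continued fraction
beginning with `w`, as long as the entries of `S` are small. -/
lemma IsCompleteQuotients.absX_approx_le {T : ℕ → InvLaurent K} {a : ℕ → K[X]}
    (ha : ∀ n, (a n).natDegree = 1) (hT : IsCompleteQuotients T a) {w : List K[X]}
    (hw : OccursAt a 0 w) (S : Matrix (Fin 2) (Fin 2) K[X]) {m : ℕ}
    (hS : ∀ i j, absX (ofPoly K (S i j)) ≤ 2 ^ m) (j : Fin 2) :
    absX (ofPoly K ((wordMatrix w * S) 1 j) * T 0 - ofPoly K ((wordMatrix w * S) 0 j))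
      * 2 ^ w.length ≤ 2 ^ (m + 1) := by
  obtain ⟨h1, h2⟩ := evalCF_mul_cfDenom (hw.natDegree_eq ha) (hT.absX_eq (0 + w.length))
  rw [← hT.eq_evalCF hw] at h2
  -- Clearing the denominator of $T_0$ collapses the entries of $M_w$ to its determinant $\pm1$;
  -- only a linear form in the column of $S$ remains.
  have h3 : (ofPoly K ((wordMatrix w * S) 1 j) * T 0 - ofPoly K ((wordMatrix w * S) 0 j)) *
      cfDenom w (T (0 + w.length)) =
      ofPoly K (wordMatrix w).det *
        (ofPoly K (S 1 j) * T (0 + w.length) - ofPoly K (S 0 j)) := by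
    rw [sub_mul, mul_assoc, h2, cfDenom, Matrix.det_fin_two]
    simp only [Matrix.mul_apply, Fin.sum_univ_two, map_add, map_mul, map_sub]
    ring
  rw [← h1, ← absX_mul, h3, absX_mul, absX_det_wordMatrix, one_mul]
  refine absX_sub_le ?_ ?_
  · rw [absX_mul, hT.absX_eq, pow_succ]
    linarith [hS 1 j]
  · rw [pow_succ]
    linarith [hS 0 j, show (0 : ℝ) < 2 ^ m by positivity]

/-- A palindrome `V` occurring after a short prefix `U` gives a simultaneous rational approximation
to the number and its inverse. -/
lemma IsCompleteQuotients.exists_of_palindrome {T : ℕ → InvLaurent K} {a : ℕ → K[X]}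
    (ha : ∀ n, (a n).natDegree = 1) (hT : IsCompleteQuotients T a) {U V : List K[X]}
    (hw : OccursAt a 0 (U ++ V)) (hV : V.reverse = V) {n : ℕ}
    (hn : 2 * U.length + 1 + n ≤ V.length) :
    ∃ q : K[X], q ≠ 0 ∧ absX (ofPoly K q) * fracNorm (ofPoly K q * T 0)
      * fracNorm (ofPoly K q * (T 0)⁻¹) ≤ (1 / 2) ^ n := by
  have hdeg := hw.natDegree_eq ha
  have hU : ∀ b ∈ U, b.natDegree = 1 := fun b hb => hdeg b (List.mem_append_left _ hb)
  set S := (wordMatrix U).transpose with hS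
  set N := wordMatrix (U ++ V) * S with hN
  set m := U.length with hm
  set v := V.length with hv
  have hNw : N = wordMatrix (U ++ V ++ U.reverse) := by
    rw [hN, hS, transpose_wordMatrix, wordMatrix_append (U ++ V)]
  -- The reversed prefix is appended only to make the word a palindrome. The series need not
  -- continue that way; the price is the factor $2^m$ bounding $S$, which cancels against the length
  -- of $U$.
  have hsymm : N 0 1 = N 1 0 := by
    have : N.transpose = N := by
      rw [hNw, transpose_wordMatrix]
      simp [hV]
    conv_lhs => rw [← this]
    rfl
  have hSle : ∀ i j, absX (ofPoly K (S i j)) ≤ 2 ^ m := fun i j => absX_wordMatrix_le hU j i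
  have happ := hT.absX_approx_le ha hw S hSle
  rw [← hN, List.length_append, ← hm, ← hv] at happ
  have happ' : ∀ j, absX (ofPoly K (N 1 j) * T 0 - ofPoly K (N 0 j)) * 2 ^ v ≤ 2 := by
    intro j
    have h1 := happ j
    rw [pow_add, pow_succ, mul_left_comm] at h1
    exact le_of_mul_le_mul_left h1 (by positivity)
  have hq : absX (ofPoly K (N 1 0)) ≤ 2 ^ (2 * m + v) := by
    have := absX_wordMatrix_le (w := U ++ V ++ U.reverse) (fun b hb => by
      rcases List.mem_append.mp hb with h | h
      · exact hdeg b h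
      · exact hU b (List.mem_reverse.mp h)) 1 0
    rw [← hNw] at this
    refine this.trans (le_of_eq ?_)
    simp only [List.length_append, List.length_reverse]
    congr 1; omega
  have hT0 := hT.absX_eq 0
  refine ⟨N 1 0, ?_, ?_⟩
  · intro h0
    have hdet : absX (ofPoly K N.det) = 1 := by rw [hNw]; exact absX_det_wordMatrix _
    have h1 := happ 0
    rw [h0, map_zero, zero_mul, zero_sub, absX_neg] at h1
    -- Otherwise $|V|\le1$, so $U$ is empty and $V$ is a single letter, whose matrix has lower left
    -- entry 1.
    have h2 : N 0 0 = 0 := by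
      by_contra h
      have h3 := one_le_absX_ofPoly h
      have h4 : (2 : ℝ) ^ (m + v) ≤ 2 ^ (m + 1) := by
        nlinarith [show (0 : ℝ) < 2 ^ (m + v) by positivity]
      rw [pow_le_pow_iff_right₀ (by norm_num)] at h4
      have hm0 : m = 0 := by omega
      have hv1 : v = 1 := by omega
      have hU0 : U = [] := List.length_eq_zero_iff.mp hm0
      obtain ⟨b, hb⟩ := List.length_eq_one_iff.mp hv1
      rw [hNw, hU0, hb] at h0
      simp [wordMatrix_cons] at h0
    rw [Matrix.det_fin_two, h0, h2] at hdet
    simp at hdet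
  · have e1 : fracNorm (ofPoly K (N 1 0) * T 0) * 2 ^ v ≤ 2 :=
      (mul_le_mul_of_nonneg_right (fracNorm_le _ (N 0 0)) (by positivity)).trans (happ' 0)
    -- By symmetry the second column approximates $T_0$ by $N_{10}/N_{11}$; dividing by $T_0$ turns
    -- this into an approximation of $T_0^{-1}$ with denominator $N_{10}$.
    have e2 : fracNorm (ofPoly K (N 1 0) * (T 0)⁻¹) * 2 ^ v ≤ 1 := by
      have h1 := fracNorm_le (ofPoly K (N 1 0) * (T 0)⁻¹) (N 1 1)
      have h2 : ofPoly K (N 1 0) * (T 0)⁻¹ - ofPoly K (N 1 1) =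
          -((ofPoly K (N 1 1) * T 0 - ofPoly K (N 0 1)) * (T 0)⁻¹) := by
        have := hT.ne_zero 0
        rw [hsymm]
        field_simp
        ring
      rw [h2, absX_neg, absX_mul, absX_inv, hT0] at h1
      have h3 := happ' 1
      have h4 := mul_le_mul_of_nonneg_right h1 (show (0 : ℝ) ≤ 2 ^ v by positivity)
      linarith
    have hf1 := fracNorm_nonneg (ofPoly K (N 1 0) * T 0)
    have hf2 := fracNorm_nonneg (ofPoly K (N 1 0) * (T 0)⁻¹)
    set f1 := fracNorm (ofPoly K (N 1 0) * T 0)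
    set f2 := fracNorm (ofPoly K (N 1 0) * (T 0)⁻¹)
    have e3 : absX (ofPoly K (N 1 0)) * f1 * f2 * 2 ^ (2 * v) ≤ 2 ^ (2 * m + v + 1) := by
      calc absX (ofPoly K (N 1 0)) * f1 * f2 * 2 ^ (2 * v)
          = absX (ofPoly K (N 1 0)) * ((f1 * 2 ^ v) * (f2 * 2 ^ v)) := by ring
        _ ≤ 2 ^ (2 * m + v) * (2 * 1) := by gcongr
        _ = 2 ^ (2 * m + v + 1) := by ring
    have e4 : (2 : ℝ) ^ (2 * m + v + 1) * 2 ^ n ≤ 2 ^ (2 * v) := by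
      rw [← pow_add]
      exact pow_le_pow_right₀ (by norm_num) (by omega)
    rw [one_div, inv_pow, ← one_div, le_div_iff₀ (by positivity)]
    have hpos : (0 : ℝ) < 2 ^ (2 * v) := by positivity
    refine le_of_mul_le_mul_right ?_ hpos
    calc absX (ofPoly K (N 1 0)) * f1 * f2 * 2 ^ n * 2 ^ (2 * v)
        = absX (ofPoly K (N 1 0)) * f1 * f2 * 2 ^ (2 * v) * 2 ^ n := by ring
      _ ≤ 2 ^ (2 * m + v + 1) * 2 ^ n := by gcongr
      _ ≤ 1 * 2 ^ (2 * v) := by rw [one_mul]; exact e4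

lemma satisfiesLittlewood_of_forall {Θ Φ : InvLaurent K}
    (h : ∀ n : ℕ, ∃ q : K[X], q ≠ 0 ∧ absX (ofPoly K q) * fracNorm (ofPoly K q * Θ)
      * fracNorm (ofPoly K q * Φ) ≤ (1 / 2) ^ n) : SatisfiesLittlewood Θ Φ := by
  have hnn : ∀ q : {q : K[X] // q ≠ 0}, 0 ≤ absX (ofPoly K (q : K[X])) *
      fracNorm (ofPoly K (q : K[X]) * Θ) * fracNorm (ofPoly K (q : K[X]) * Φ) := fun q =>
    mul_nonneg (mul_nonneg (absX_nonneg _) (fracNorm_nonneg _)) (fracNorm_nonneg _)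
  refine le_antisymm ?_ (Real.iInf_nonneg hnn)
  refine ge_of_tendsto' (tendsto_pow_atTop_nhds_zero_of_lt_one (r := (1 / 2 : ℝ)) (by norm_num)
    (by norm_num)) fun n => ?_
  obtain ⟨q, hq, hle⟩ := h n
  exact (ciInf_le ⟨0, by rintro _ ⟨q, rfl⟩; exact hnn q⟩ (⟨q, hq⟩ : {q : K[X] // q ≠ 0})).trans hle

/-! ### Subwords and lengths of the blocks -/

lemma OccursAt.left {a : ℕ → K[X]} {i : ℕ} {u w : List K[X]} (h : OccursAt a i (u ++ w)) :
    OccursAt a i u := by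
  intro j hj
  rw [h j (by simp; omega), List.getElem_append_left hj]

lemma OccursAt.right {a : ℕ → K[X]} {i : ℕ} {u w : List K[X]} (h : OccursAt a i (u ++ w)) :
    OccursAt a (i + u.length) w := by
  intro j hj
  rw [add_assoc, h (u.length + j) (by simpa using hj), List.getElem_append_right (by omega)]
  simp

lemma OccursAt.head {a : ℕ → K[X]} {i : ℕ} {b : K[X]} {w : List K[X]}
    (h : OccursAt a i (b :: w)) : a i = b :=
  h 0 (by simp)

lemma OccursAt.mem {a : ℕ → K[X]} {i : ℕ} {w : List K[X]} (h : OccursAt a i w) {n : ℕ}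
    (h1 : i ≤ n) (h2 : n < i + w.length) : a n ∈ w := by
  obtain ⟨j, rfl⟩ := Nat.exists_eq_add_of_le h1
  rw [h j (by omega)]
  exact List.getElem_mem _

lemma blocks_succ (p N : ℕ) : blocks K p (N + 1) = blocks K p N ++ block K p N := by
  simp [blocks, List.range_succ]

lemma blocks_succ_eq_cons (p N : ℕ) : blocks K p (N + 1) =
    block K p 0 ++ (List.range N).flatMap fun k => block K p (k + 1) := by
  rw [blocks, List.range_succ_eq_map, List.flatMap_cons, List.flatMap_map]

lemma length_block {p k : ℕ} (hp : Odd p) : (block K p k).length = 2 * p ^ k := by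
  obtain ⟨m, hm⟩ := hp.pow (n := k)
  simp only [block, List.length_cons, List.length_append, length_wordPow, List.length_nil]
  omega

lemma length_blocks {p : ℕ} (hp : Odd p) (N : ℕ) :
    (blocks K p N).length * (p - 1) + 2 = 2 * p ^ N := by
  induction N with
  | zero => simp [blocks]
  | succ N ih =>
    obtain ⟨m, hm⟩ := hp
    rw [blocks_succ, List.length_append, length_block ⟨m, hm⟩, add_mul, pow_succ,
      show p - 1 = 2 * m by omega]
    rw [show p - 1 = 2 * m by omega] at ih
    have h2 : 2 * (p ^ N * p) = 2 * p ^ N * (2 * m) + 2 * p ^ N := by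
      conv_lhs => rw [hm]
      rw [hm]; ring
    omega

lemma le_length_blocks (p N : ℕ) : N ≤ (blocks K p N).length := by
  induction N with
  | zero => simp
  | succ N ih =>
    rw [blocks_succ, List.length_append]
    simp only [block, List.length_cons]
    omega

lemma le_length_flatMap_block (p N : ℕ) :
    N ≤ ((List.range N).flatMap fun k => block K p (k + 1)).length := by
  induction N with
  | zero => simp
  | succ N ih =>
    have : 1 ≤ (block K p (N + 1)).length := by simp [block]
    rw [List.range_succ, List.flatMap_append, List.length_append, List.flatMap_singleton]
    omega

lemma blocks_prefix (p : ℕ) {M N : ℕ} (h : M ≤ N) : blocks K p M <+: blocks K p N := by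
  induction N, h using Nat.le_induction with
  | base => exact List.prefix_rfl
  | succ N _ ih => rw [blocks_succ]; exact ih.trans (List.prefix_append _ _)

/-! ### The series $\Theta_p$ -/

section Prime
variable (p : ℕ) [Fact p.Prime]

lemma occursAt_blocks (N : ℕ) : OccursAt (millsRobbinsQuotient p) 0 (blocks (ZMod p) p N) := by
  intro j hj
  have h1 : j < (blocks (ZMod p) p (j + 1)).length :=
    (Nat.lt_succ_self j).trans_le (le_length_blocks p (j + 1))
  rw [zero_add, millsRobbinsQuotient, List.getD_eq_getElem _ _ h1]
  rcases le_total N (j + 1) with h | h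
  · exact ((blocks_prefix p h).getElem hj).symm
  · exact (blocks_prefix p h).getElem h1

lemma occursAt_block (N : ℕ) : OccursAt (millsRobbinsQuotient p) (blocks (ZMod p) p N).length
    (block (ZMod p) p N) := by
  have h := occursAt_blocks p (N + 1)
  rw [blocks_succ] at h
  simpa using h.right

lemma natDegree_eq_one_of_mem_block (h3 : (3 : ZMod p) ≠ 0) {k : ℕ} {a : (ZMod p)[X]}
    (ha : a ∈ block (ZMod p) p k) : a.natDegree = 1 := by
  simp only [block, List.mem_cons, List.mem_append] at ha
  rcases ha with rfl | ha | rfl | ha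
  · exact natDegree_X
  · have := mem_of_mem_wordPow ha
    simp only [List.mem_cons, List.not_mem_nil, or_false] at this
    rcases this with rfl | rfl
    · exact natDegree_C_mul_X _ (inv_ne_zero h3)
    · exact natDegree_C_mul_X _ h3
  · rw [natDegree_neg]; exact natDegree_C_mul_X _ (inv_ne_zero h3)
  · have := mem_of_mem_wordPow ha
    simp only [List.mem_cons, List.not_mem_nil, or_false, or_self] at this
    rw [this, natDegree_neg, natDegree_X]

lemma natDegree_millsRobbinsQuotient (h3 : (3 : ZMod p) ≠ 0) (n : ℕ) :
    (millsRobbinsQuotient p n).natDegree = 1 := by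
  have hn : n < (blocks (ZMod p) p (n + 1)).length :=
    (Nat.lt_succ_self n).trans_le (le_length_blocks p (n + 1))
  have h := (occursAt_blocks p (n + 1)).mem (Nat.zero_le n) (by simpa using hn)
  obtain ⟨k, -, hk⟩ := List.mem_flatMap.mp h
  exact natDegree_eq_one_of_mem_block p h3 hk

variable {p}
variable {T : ℕ → InvLaurent (ZMod p)}

/-- The blocks of index $0,\dots,N-1$ are transduced into those of index $1,\dots,N$, which start at
position 2, the length of the block of index 0. Both sides thus begin with the same word of length
at least $N$, for every $N$. -/
lemma raney_pow_eq {r : ℕ} (hr : p = 2 * r + 3) (h3 : (3 : ZMod p) ≠ 0)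
    (hT : IsCompleteQuotients T (millsRobbinsQuotient p)) : raney p (-1) (T 0 ^ p) = T 2 := by
  refine eq_of_absX_sub_le (c := 2) fun N => ?_
  set w := (List.range N).flatMap fun k => block (ZMod p) p (k + 1) with hw
  have ht : Transduces p (-1) (-1) (blocks (ZMod p) p N) w := by
    rw [hw]
    clear hw w
    induction N with
    | zero => simpa [blocks] using Transduces.nil (p := p) (-1)
    | succ N ih =>
      rw [blocks_succ, List.range_succ, List.flatMap_append, List.flatMap_singleton]
      exact ih.append (transduces_block hr h3 N)
  have hocc : OccursAt (millsRobbinsQuotient p) 2 w := by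
    have h := occursAt_blocks p (N + 1)
    rw [blocks_succ_eq_cons] at h
    have h' := h.right
    rwa [show (block (ZMod p) p 0).length = 2 by simp [block], zero_add] at h'
  have hlen : N ≤ w.length := le_length_flatMap_block p N
  rw [hT.eq_evalCF (occursAt_blocks p N), ht.eq _ (hT.absX_eq _), hT.eq_evalCF hocc]
  refine (absX_evalCF_sub ht.natDegree_eq' (absX_raney p (Fact.out : p.Prime).two_le _ ?_)
    (hT.absX_eq _)).trans ?_
  · rw [absX_pow, hT.absX_eq]
  · gcongr 2 * ?_
    exact pow_le_pow_of_le_one (by norm_num) (by norm_num) hlen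

lemma eval₂_millsRobbinsPoly {r : ℕ} (hr : p = 2 * r + 3) (h3 : (3 : ZMod p) ≠ 0)
    (hT : IsCompleteQuotients T (millsRobbinsQuotient p)) :
    (millsRobbinsPoly p).eval₂ (ofPoly (ZMod p)) (T 0) = 0 := by
  have hocc := occursAt_blocks p 1
  have hblock : blocks (ZMod p) p 1 = [X, -(C 3⁻¹ * X)] := by simp [blocks, block]
  rw [hblock] at hocc
  have h0 := hT.eq 0
  have h1 := hT.eq 1
  rw [hocc.head] at h0
  rw [hocc.tail.head, map_neg, map_mul] at h1
  have h2 := raney_pow_eq hr h3 hT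
  have hg0 : ofPoly (ZMod p) (fibPoly _ (p - 1)) ≠ 0 :=
    ne_zero_of_absX_pos (by rw [absX_fibPoly]; positivity)
  rw [raney, div_eq_iff hg0, C_neg, C_1, neg_one_mul, map_neg, sub_neg_eq_add] at h2
  have hcc : (3 * ofPoly _ (C (3⁻¹ : ZMod p)) : InvLaurent (ZMod p)) = 1 := by
    rw [← map_ofNat (ofPoly (ZMod p)) 3, ← map_mul, ← C_ofNat, ← C_mul, mul_inv_cancel₀ h3, C_1,
      map_one]
  have k0 : (T 0 - ofPoly _ X) * T 1 = 1 := by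
    rw [sub_eq_of_eq_add' h0, inv_mul_cancel₀ (hT.ne_zero 1)]
  have k1 : T 1 * T 2 = -(ofPoly _ (C 3⁻¹) * ofPoly _ X) * T 2 + 1 := by
    rw [h1, add_mul, inv_mul_cancel₀ (hT.ne_zero 2)]
  -- This is $\Theta=[X,-X/3,T_2]$ with denominators cleared; eliminating $T_2$ with `h2` gives the
  -- equation.
  have k2 : (T 0 - ofPoly _ X) * (3 - ofPoly _ X * T 2) = 3 * T 2 := by
    linear_combination 3 * T 2 * k0 - 3 * (T 0 - ofPoly _ X) * k1
      + (T 0 - ofPoly _ X) * ofPoly _ X * T 2 * hcc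
  simp only [millsRobbinsPoly, eval₂_add, eval₂_sub, eval₂_mul, eval₂_C, eval₂_X, eval₂_pow]
  simp only [map_add, map_sub, map_mul, map_neg, map_pow, map_ofNat]
  linear_combination (ofPoly _ X * T 0 - ofPoly _ X ^ 2 + 3) * h2
    - ofPoly _ (fibPoly _ (p - 1)) * k2

lemma natDegree_millsRobbinsPoly : (millsRobbinsPoly p).natDegree = p + 1 := by
  have hp := (Fact.out : p.Prime).two_le
  apply natDegree_eq_of_le_of_coeff_ne_zero
  · rw [millsRobbinsPoly]
    have hX := natDegree_X_pow_le (R := (ZMod p)[X])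
    refine natDegree_add_le_of_degree_le (natDegree_add_le_of_degree_le
      ((natDegree_sub_le_of_le (m := p + 1) (n := p + 1) ?_ ?_).trans (max_self _).le) ?_) ?_
    · exact (natDegree_C_mul_le _ _).trans (hX _)
    · exact (natDegree_C_mul_le _ _).trans ((hX _).trans (Nat.le_succ _))
    · exact (natDegree_C_mul_le _ _).trans (natDegree_X_le.trans (by omega))
    · rw [natDegree_C]; omega
  · rw [millsRobbinsPoly, coeff_add, coeff_add, coeff_sub, coeff_C_mul, coeff_C_mul, coeff_C_mul,
      coeff_X_pow, coeff_X_pow, coeff_X, coeff_C, if_pos rfl, if_neg (by omega), if_neg (by omega),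
      if_neg (by omega)]
    simp

lemma independentWithOne_millsRobbins (hodd : Odd p) (h3 : (3 : ZMod p) ≠ 0)
    (h2 : (2 : ZMod p) ≠ 0) (h10 : (10 : ZMod p) ≠ 0)
    (hT : IsCompleteQuotients T (millsRobbinsQuotient p)) :
    IndependentWithOne (T 0) (T 0)⁻¹ := by
  by_contra hcon
  obtain ⟨i, d, hd, hper⟩ := hT.exists_periodic_of_not_independent hcon
  -- The block of index $k$ starts beyond $i+d$, and its $L_k(3)$ has length $p^k-1\ge d$. So the
  -- letter $d$ places before $-X/3$ is $X/3$ or $3X$, and periodicity would give $2=0$ or $10=0$ in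
  -- $\mathbb F_p$.
  set k := i + d + 1
  set l := (p ^ k - 1) / 2 with hl
  set s := (blocks (ZMod p) p k).length
  have hs : k ≤ s := le_length_blocks p k
  have hdl : d ≤ 2 * l := by
    obtain ⟨m, hm⟩ := hodd.pow (n := k)
    have := Nat.lt_pow_self (Fact.out : p.Prime).one_lt (n := k)
    omega
  have hocc := (occursAt_block p k).tail
  rw [← hl] at hocc
  have hw : (wordPow [C (3⁻¹ : ZMod p) * X, C 3 * X] l).length = 2 * l := by
    rw [length_wordPow, mul_comm]; rfl
  have h1 := hocc.right.head
  rw [hw] at h1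
  have hmem := mem_of_mem_wordPow (hocc.left.mem (n := s + 1 + 2 * l - d) (by omega) (by
    rw [hw]; omega))
  rw [← hper _ (by omega), show s + 1 + 2 * l - d + d = s + 1 + 2 * l by omega, h1] at hmem
  simp only [List.mem_cons, List.not_mem_nil, or_false] at hmem
  have h33 : (3 : ZMod p) * 3⁻¹ = 1 := mul_inv_cancel₀ h3
  rcases hmem with h | h
  all_goals
    have hc := congrArg (fun P : (ZMod p)[X] => P.coeff 1) h
    simp only [coeff_neg, coeff_C_mul, coeff_X_one, mul_one] at hc
  · exact h2 (by linear_combination (-3) * hc - 2 * h33)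
  · exact h10 (by linear_combination (-3) * hc - h33)

lemma cons_wordPow_comm {α : Type*} (a b : α) (l : ℕ) :
    a :: wordPow [b, a] l = wordPow [a, b] l ++ [a] := by
  induction l with
  | zero => simp
  | succ l ih => rw [wordPow_succ, wordPow_succ [a, b], List.append_assoc, ← ih]; simp

lemma reverse_wordPow {α : Type*} (W : List α) (l : ℕ) :
    (wordPow W l).reverse = wordPow W.reverse l := by
  induction l with
  | zero => simp
  | succ l ih =>
    rw [wordPow_succ, List.reverse_append, ih, wordPow_add]
    simp [wordPow_succ]

lemma satisfiesLittlewood_millsRobbins (hp : 7 ≤ p) (hodd : Odd p) (h3 : (3 : ZMod p) ≠ 0)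
    (hT : IsCompleteQuotients T (millsRobbinsQuotient p)) :
    SatisfiesLittlewood (T 0) (T 0)⁻¹ := by
  refine satisfiesLittlewood_of_forall fun n => ?_
  -- With $p-1\ge6$, the prefix satisfies $|U|\le(p^k-1)/3+1$ while $|V|=p^k-2$, so $2|U|+1+n\le|V|$
  -- holds once $p^k\ge3n+13$, and $p^k>k$.
  set k := 3 * n + 13
  have hk := Nat.lt_pow_self (Fact.out : p.Prime).one_lt (n := k)
  obtain ⟨l, hl⟩ := hodd.pow (n := k)
  obtain ⟨l, rfl⟩ : ∃ l', l = l' + 1 := ⟨l - 1, by omega⟩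
  -- The last letter $3X$ of $L_k(3)$ is dropped: the alternating word of odd length is a
  -- palindrome.
  set V : List (ZMod p)[X] := wordPow [C (3⁻¹ : ZMod p) * X, C 3 * X] l ++ [C 3⁻¹ * X] with hV
  have hocc := occursAt_blocks p (k + 1)
  rw [blocks_succ, block, hl, show (2 * (l + 1) + 1 - 1) / 2 = l + 1 by omega, wordPow_add,
    wordPow_succ _ 0, wordPow_zero] at hocc
  have hpre : OccursAt (millsRobbinsQuotient p) 0 ((blocks (ZMod p) p k ++ (X :: [])) ++ V) := by
    refine OccursAt.left (w := C 3 * X :: (-(C (3⁻¹ : ZMod p) * X) ::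
      wordPow [-X, -X] (l + 1))) ?_
    simpa [hV, wordPow_add, wordPow_succ] using hocc
  refine hT.exists_of_palindrome (natDegree_millsRobbinsQuotient p h3) hpre ?_ ?_
  · rw [hV, List.reverse_append, reverse_wordPow, ← cons_wordPow_comm]
    rfl
  · have hlen := length_blocks (K := ZMod p) hodd k
    have hlen6 : (blocks (ZMod p) p k).length * 6 ≤ (blocks (ZMod p) p k).length * (p - 1) :=
      Nat.mul_le_mul_left _ (by omega)
    rw [hV, List.length_append, List.length_append, length_wordPow]
    simp only [List.length_cons, List.length_nil]
    omega

end Prime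

end PowerSeriesLittlewood

end

theorem theorem7 (p : ℕ) [Fact p.Prime] (hp : 7 ≤ p) :
    ∃ Θ : InvLaurent (ZMod p),
      (∀ F : InvLaurent (ZMod p),
        HasContinuedFraction F (millsRobbinsQuotient p) ↔ F = Θ) ∧
      (millsRobbinsPoly p).natDegree = p + 1 ∧
      (millsRobbinsPoly p).eval₂ (ofPoly (ZMod p)) Θ = 0 ∧
      SatisfiesLittlewoodNontrivially Θ Θ⁻¹ := by
  have hprime : p.Prime := Fact.out
  have hodd : Odd p := hprime.odd_of_ne_two (by omega)
  have hne : ∀ q : ℕ, q.Prime → q < 7 → (q : ZMod p) ≠ 0 := by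
    intro q hq hq7 h
    rw [ZMod.natCast_eq_zero_iff, Nat.prime_dvd_prime_iff_eq hprime hq] at h
    omega
  have h2 : (2 : ZMod p) ≠ 0 := by exact_mod_cast hne 2 Nat.prime_two (by norm_num)
  have h3 : (3 : ZMod p) ≠ 0 := by exact_mod_cast hne 3 Nat.prime_three (by norm_num)
  have h5 : (5 : ZMod p) ≠ 0 := by exact_mod_cast hne 5 Nat.prime_five (by norm_num)
  have h10 : (10 : ZMod p) ≠ 0 := by
    have := mul_ne_zero h2 h5
    norm_num at this
    exact this
  obtain ⟨r, hr⟩ : ∃ r, p = 2 * r + 3 := by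
    obtain ⟨m, hm⟩ := hodd
    exact ⟨m - 1, by omega⟩
  obtain ⟨T, hT⟩ := exists_isCompleteQuotients (natDegree_millsRobbinsQuotient p h3)
  exact ⟨T 0, hasContinuedFraction_iff (natDegree_millsRobbinsQuotient p h3) hT,
    natDegree_millsRobbinsPoly, eval₂_millsRobbinsPoly hr h3 hT,
    satisfiesLittlewood_millsRobbins hp hodd h3 hT,
    mem_Bad_of_le (by norm_num) fun _ r hq => hT.half_le hq 0 r,
    mem_Bad_of_le (by norm_num) fun _ r hq => hT.half_le_inv hq 0 r,
    independentWithOne_millsRobbins hodd h3 h2 h10 hT⟩
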